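/- Let $\Bbbk$ be a field of characteristic different from $2$ and let $N=|\mathbf x|\ge 0$. Let $\mathcal C$ be the KLRW category with $N$ punctures, regarded as an $A_\infty$-category: its objects are $T_0,\dots,T_N$; $\mathrm{Hom}(T_i,T_j)=\bigoplus_{\alpha\ge 0}\Bbbk\,a_{ji}s^\alpha$ is concentrated in degree $0$; $\mu^d=0$ for $d\neq 2$, and $$\mu^2(a_{kj}s^\beta,a_{ji}s^\alpha)=a_{ki}s^{\beta+\alpha+\delta(i,j,k)},\qquad \delta(i,j,k)=\begin{cases}0,&(i-j)(j-k)\ge 0,\\ \min(|i-j|,|j-k|),&(i-j)(j-k)<0.\end{cases}$$ Let $\mathrm{HH}^2(\Delta)=H^2\mathrm{Hom}(\mathrm{id},\mathrm{id})$ be the space of degree-$2$ $A_\infty$-natural transformations $\mathrm{id}_{\mathcal C}\Rightarrow\mathrm{id}_{\mathcal C}$ (degree-$2$ pre-natural transformations $\eta=(\eta^d)_{d\ge0}$, $\eta^d$ of degree $2-d$, with $\mu^1(\eta)=0$) modulo those of the form $\mu^1(\theta)$ with $\theta$ a pre-natural transformation of degree $1$. For $\vartheta=(\vartheta_1,\dots,\vartheta_{N-1})\in\Bbbk^{N-1}$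 (with $\Bbbk^{N-1}:=0$ if $N=0$) put $\vartheta_0=\vartheta_N=0$ and $$\mathfrak C(a_{kj}s^\beta,a_{ji}s^\alpha)=\begin{cases} -\beta\vartheta_j-\sum_{t=1}^{j-i-1}2\beta\,\vartheta_{j-t}-\beta\vartheta_i,& i<j<k,\\ -\beta\vartheta_j-\sum_{t=1}^{j-k}2(\beta+t)\vartheta_{j-t}-\sum_{t=j-k+1}^{j-i-1}2(\beta+j-k)\vartheta_{j-t}-(\beta+j-k)\vartheta_i,& i<k\le j,\\ -\beta\vartheta_j-\sum_{t=1}^{j-i}2(\beta+t)\vartheta_{j-t}+(\beta+j-i)\vartheta_i,& k\le i<j,\\ \beta\vartheta_j+\sum_{t=1}^{i-j-1}2\beta\,\vartheta_{j+t}+\beta\vartheta_i,& k<j<i,\\ \beta\vartheta_j+\sum_{t=1}^{k-j}2(\beta+t)\vartheta_{j+t}+\sum_{t=k-j+1}^{i-j-1}2(\beta+k-j)\vartheta_{j+t}+(\beta+k-j)\vartheta_i,& j\le k<i,\\ \beta\vartheta_j+\sum_{t=1}^{i-j}2(\beta+t)\vartheta_{j+t}-(\beta+i-j)\vartheta_i,&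 j<i\le k,\\ 0,& i=j. \end{cases}$$ Then for every $\vartheta\in\Bbbk^{N-1}$ there is a degree-$2$ $A_\infty$-natural transformation $\eta_\vartheta\colon\mathrm{id}\Rightarrow\mathrm{id}$, depending linearly on $\vartheta$, with $$\eta_\vartheta^2(a_{kj}s^\beta,a_{ji}s^\alpha)=\mathfrak C(a_{kj}s^\beta,a_{ji}s^\alpha)\,a_{ki}s^{\beta+\alpha+\delta(i,j,k)-1},\qquad \eta_\vartheta^d=0\ \text{ for } d\ne 2$$ (where $\mathfrak C\neq0$ forces $\beta+\alpha+\delta(i,j,k)\ge1$), and $\vartheta\mapsto[\eta_\vartheta]$ is a linear isomorphism $\Bbbk^{N-1}\cong\mathrm{HH}^2(\Delta)$. Moreover $\mathfrak C$ is given by the following strand-sliding rule. Draw the path $a_{kj}s^\beta a_{ji}$ as a black strand from position $i$ (bottom) to position $j$, where it carries $\beta$ dots, to position $k$ (top), and slide its middle part from $j$ to $i$ across one red strand at a time. If $j>i$, sliding the middle with $b$ dots from $m$ to $m-1$ contributes $b(\vartheta_m+\vartheta_{m-1})$; if moreover $k<m$ (so that the strand turns back), it contributes an additional $\vartheta_{m-1}$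 and the number of dots in the middle becomes $b+1$, while otherwise it stays $b$. If $j<i$, the rule is the mirror image, with $m+1$ in place of $m-1$ and $k>m$ in place of $k<m$. Then $\mathfrak C$ is the sum of all contributions, with an overall minus sign if $j>i$. -/

import Mathlib

open Finset

noncomputable section

namespace KLRW

/-! ### The KLRW category with `N` punctures

Objects `T_0, …, T_N`; the space of morphisms `T_i ⟶ T_j` has the basis `a_{ji} s^α` (`α ∈ ℕ`), all in
degree `0`; `μ² (a_{kj} s^β, a_{ji} s^α) = a_{ki} s^{β+α+δ(i,j,k)}` and `μ^d = 0` for `d ≠ 2`. -/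

/-- The objects `T_0, …, T_N`. -/
abbrev Ob (N : ℕ) : Type := Fin (N + 1)

/-- The morphisms `T_i ⟶ T_j`; the coefficient at `α` is the one of `a_{ji} s^α`. -/
abbrev Mor (k : Type*) [Field k] {N : ℕ} (_i _j : Ob N) : Type _ := ℕ →₀ k

/-- The basis element `a_{ji} s^α` of the morphisms `T_i ⟶ T_j`. -/
def gen (k : Type*) [Field k] {N : ℕ} (j i : Ob N) (α : ℕ) : Mor k i j := Finsupp.single α 1

/-- The degree `g` part of the graded space of morphisms: everything is in degree `0`. -/
def degPart (k : Type*) [Field k] {N : ℕ} (i j : Ob N) (g : ℤ) : Submodule k (Mor k i j) :=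
  if g = 0 then ⊤ else ⊥

/-- `δ(i,j,l)`. -/
def delta (i j l : ℕ) : ℕ :=
  if 0 ≤ ((i : ℤ) - j) * ((j : ℤ) - l) then 0
  else min ((i : ℤ) - j).natAbs ((j : ℤ) - l).natAbs

/-- The bilinear composition `a_{lj} s^β ⊗ a_{ji} s^α ↦ a_{li} s^{β+α+δ(i,j,l)}`. -/
def comp (k : Type*) [Field k] {N : ℕ} (i j l : Ob N) :
    Mor k j l →ₗ[k] Mor k i j →ₗ[k] Mor k i l :=
  Finsupp.linearCombination k (fun β : ℕ =>
    Finsupp.lmapDomain k k (fun α : ℕ => β + α + delta i j l))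

/-- Families of multilinear maps `Hom(X_{d-1},X_d) ⊗ ⋯ ⊗ Hom(X_0,X_1) → Hom(X_0,X_d)`, one for each
`d ≥ 0` and each `X_0, …, X_d`. The argument with index `p : Fin d` is the morphism
`a_{p+1} : X_p ⟶ X_{p+1}`, so the arguments are listed in the order `a_1, …, a_d`. -/
def Family (k : Type*) [Field k] (N : ℕ) : Type _ :=
  ∀ (d : ℕ) (X : Fin (d + 1) → Ob N),
    MultilinearMap k (fun p : Fin d => Mor k (X p.castSucc) (X p.succ))
      (Mor k (X 0) (X (Fin.last d)))

/-- Families are added componentwise. -/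
instance (k : Type*) [Field k] (N : ℕ) : AddCommGroup (Family k N) :=
  inferInstanceAs (AddCommGroup (∀ (d : ℕ) (X : Fin (d + 1) → Ob N),
    MultilinearMap k (fun p : Fin d => Mor k (X p.castSucc) (X p.succ))
      (Mor k (X 0) (X (Fin.last d)))))

/-- Scalars act on families componentwise. -/
instance (k : Type*) [Field k] (N : ℕ) : Module k (Family k N) :=
  inferInstanceAs (Module k (∀ (d : ℕ) (X : Fin (d + 1) → Ob N),
    MultilinearMap k (fun p : Fin d => Mor k (X p.castSucc) (X p.succ))
      (Mor k (X 0) (X (Fin.last d)))))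

/-- The structure maps `μ^d`. -/
def mu (k : Type*) [Field k] (N : ℕ) : Family k N
  | 2, X =>
    { toFun := fun a => comp k (X 0) (X 1) (X 2) (a 1) (a 0)
      map_update_add' := by
        intro _ m p x y
        fin_cases p <;> simp [Function.update]
      map_update_smul' := by
        intro _ m p c x
        fin_cases p <;> simp [Function.update] }
  | _, _ => 0

/-! ### `A_∞`-pre-natural transformations `id ⇒ id`, their differential, Hochschild cohomology -/

/-- Degree `g` pre-natural transformations `η : id ⇒ id`: families in which `η^d` has
degree `g - d`. -/
def PreNat (k : Type*) [Field k] (N : ℕ) (g : ℤ) : Submodule k (Family k N) where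
  carrier := {η | ∀ (d : ℕ) (X : Fin (d + 1) → Ob N) (e : Fin d → ℤ)
    (a : ∀ p : Fin d, Mor k (X p.castSucc) (X p.succ)),
    (∀ p, a p ∈ degPart k (X p.castSucc) (X p.succ) (e p)) →
      η d X a ∈ degPart k (X 0) (X (Fin.last d)) (∑ p, e p + g - d)}
  add_mem' h h' d X e a ha := Submodule.add_mem _ (h d X e a ha) (h' d X e a ha)
  zero_mem' _ _ _ _ _ := Submodule.zero_mem _
  smul_mem' c _ h d X e a ha := Submodule.smul_mem _ c (h d X e a ha)

/-- The value `η^d(a_d, …, a_1)` on the first `d` members of a composable sequence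
`X_0 ⟶ X_1 ⟶ X_2 ⟶ ⋯`, where `a p : X_p ⟶ X_{p+1}` is the morphism `a_{p+1}`. -/
def ev {k : Type*} [Field k] {N : ℕ} (η : Family k N) (d : ℕ) (X : ℕ → Ob N)
    (a : ∀ p, Mor k (X p) (X (p + 1))) : Mor k (X 0) (X d) :=
  η d (fun p => X p) (fun p => a p)

/-- The value `η^s(a_{n+s}, …, a_{n+1})`. -/
def evFrom {k : Type*} [Field k] {N : ℕ} (η : Family k N) (n s : ℕ) (X : ℕ → Ob N)
    (a : ∀ p, Mor k (X p) (X (p + 1))) : Mor k (X n) (X (n + s)) :=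
  ev η s (fun p => X (n + p)) (fun p => a (n + p))

/-- The objects `X_0, …, X_n, X_{n+s}, X_{n+s+1}, …`. -/
def contractOb {N : ℕ} (n s : ℕ) (X : ℕ → Ob N) (p : ℕ) : Ob N :=
  if p ≤ n then X p else X (p + s - 1)

/-- The morphisms `a_1, …, a_n, v, a_{n+s+1}, a_{n+s+2}, …` (with `v : X_n ⟶ X_{n+s}`). -/
def contractMor {k : Type*} [Field k] {N : ℕ} (n s : ℕ) (X : ℕ → Ob N)
    (a : ∀ p, Mor k (X p) (X (p + 1))) (v : Mor k (X n) (X (n + s))) (p : ℕ) :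
    Mor k (contractOb n s X p) (contractOb n s X (p + 1)) :=
  if p < n then a p else if p = n then v else a (p + s - 1)

/-- The value `η^{d-s+1}(a_d, …, a_{n+s+1}, ζ^s(a_{n+s}, …, a_{n+1}), a_n, …, a_1)`. -/
def brace {k : Type*} [Field k] {N : ℕ} (η ζ : Family k N) (d n s : ℕ) (X : ℕ → Ob N)
    (a : ∀ p, Mor k (X p) (X (p + 1))) : Mor k (X 0) (X d) :=
  ev η (d - s + 1) (contractOb n s X) (contractMor n s X a (evFrom ζ n s X a))

/-- `✠_n = |a_1| + ⋯ + |a_n| - n`; here every morphism has degree `0`. -/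
def maltese (n : ℕ) : ℤ := -(n : ℤ)

/-- The differential `μ¹(η)^d(a_d, …, a_1)` of a degree `g` pre-natural transformation
`η : id ⇒ id`, namely
`∑ (-1)^{(g-1)✠_n} μ^{d-s+1}(a_d, …, η^s(a_{n+s}, …, a_{n+1}), a_n, …, a_1)`
`- ∑ (-1)^{✠_n+g-1} η^{d-m+1}(a_d, …, μ^m(a_{n+m}, …, a_{n+1}), a_n, …, a_1)`. -/
def diffFun {k : Type*} [Field k] {N : ℕ} (g : ℤ) (η : Family k N) (d : ℕ) (X : ℕ → Ob N)
    (a : ∀ p, Mor k (X p) (X (p + 1))) : Mor k (X 0) (X d) :=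
  ∑ s ∈ range (d + 1), ∑ n ∈ range (d - s + 1),
      (-1 : k) ^ ((g - 1) * maltese n) • brace (mu k N) η d n s X a
    - ∑ m ∈ range (d + 1), ∑ n ∈ range (d - m + 1),
      (-1 : k) ^ (maltese n + g - 1) • brace η (mu k N) d n m X a

/-- Functions on composable sequences, the home of the values of the differential. -/
abbrev Values (k : Type*) [Field k] (N : ℕ) : Type _ :=
  ∀ (d : ℕ) (X : ℕ → Ob N), (∀ p, Mor k (X p) (X (p + 1))) → Mor k (X 0) (X d)

theorem contractMor_eq_update {k : Type*} [Field k] {N : ℕ} (d n s : ℕ) (hn : n < d)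
    (X : ℕ → Ob N) (a : ∀ p, Mor k (X p) (X (p + 1))) (v : Mor k (X n) (X (n + s))) :
    (fun p : Fin d => contractMor n s X a v p) =
      Function.update (fun p : Fin d => contractMor n s X a 0 p) ⟨n, hn⟩ v := by
  funext p
  by_cases h : p = ⟨n, hn⟩
  · subst h
    simp [contractMor]
  · have h' : (p : ℕ) ≠ n := fun e => h (Fin.ext e)
    simp [Function.update, h, contractMor, h']

theorem brace_add_right {k : Type*} [Field k] {N : ℕ} (η ζ ζ' : Family k N) {d n s : ℕ}
    (h : n < d - s + 1) (X : ℕ → Ob N) (a : ∀ p, Mor k (X p) (X (p + 1))) :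
    brace η (ζ + ζ') d n s X a = brace η ζ d n s X a + brace η ζ' d n s X a := by
  have e : evFrom (ζ + ζ') n s X a = evFrom ζ n s X a + evFrom ζ' n s X a := rfl
  simp only [brace, e]
  unfold ev
  rw [contractMor_eq_update _ n s h, contractMor_eq_update _ n s h X a (evFrom ζ n s X a),
    contractMor_eq_update _ n s h X a (evFrom ζ' n s X a)]
  exact MultilinearMap.map_update_add _ _ _ _ _

theorem brace_smul_right {k : Type*} [Field k] {N : ℕ} (c : k) (η ζ : Family k N) {d n s : ℕ}
    (h : n < d - s + 1) (X : ℕ → Ob N) (a : ∀ p, Mor k (X p) (X (p + 1))) :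
    brace η (c • ζ) d n s X a = c • brace η ζ d n s X a := by
  have e : evFrom (c • ζ) n s X a = c • evFrom ζ n s X a := rfl
  simp only [brace, e]
  unfold ev
  rw [contractMor_eq_update _ n s h, contractMor_eq_update _ n s h X a (evFrom ζ n s X a)]
  exact MultilinearMap.map_update_smul _ _ _ _ _

/-- The differential as a linear map. -/
def diff (k : Type*) [Field k] (N : ℕ) (g : ℤ) : Family k N →ₗ[k] Values k N where
  toFun η := diffFun g η
  map_add' η η' := by
    funext d X a
    have h1 : ∀ s ∈ range (d + 1), ∀ n ∈ range (d - s + 1),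
        (-1 : k) ^ ((g - 1) * maltese n) • brace (mu k N) (η + η') d n s X a =
          (-1 : k) ^ ((g - 1) * maltese n) • brace (mu k N) η d n s X a +
          (-1 : k) ^ ((g - 1) * maltese n) • brace (mu k N) η' d n s X a := by
      intro s _ n hn
      rw [brace_add_right _ _ _ (mem_range.1 hn), smul_add]
    have h2 : ∀ m n, (-1 : k) ^ (maltese n + g - 1) • brace (η + η') (mu k N) d n m X a =
          (-1 : k) ^ (maltese n + g - 1) • brace η (mu k N) d n m X a +
          (-1 : k) ^ (maltese n + g - 1) • brace η' (mu k N) d n m X a := by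
      intro m n
      rw [← smul_add]
      rfl
    change diffFun g (η + η') d X a = diffFun g η d X a + diffFun g η' d X a
    unfold diffFun
    rw [sum_congr rfl (fun s hs => sum_congr rfl (h1 s hs)),
      sum_congr rfl (fun m _ => sum_congr rfl (fun n _ => h2 m n))]
    simp only [sum_add_distrib]
    abel
  map_smul' c η := by
    funext d X a
    have h1 : ∀ s ∈ range (d + 1), ∀ n ∈ range (d - s + 1),
        (-1 : k) ^ ((g - 1) * maltese n) • brace (mu k N) (c • η) d n s X a =
          c • ((-1 : k) ^ ((g - 1) * maltese n) • brace (mu k N) η d n s X a) := by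
      intro s _ n hn
      rw [brace_smul_right _ _ _ (mem_range.1 hn), smul_comm]
    have h2 : ∀ m n, (-1 : k) ^ (maltese n + g - 1) • brace (c • η) (mu k N) d n m X a =
          c • ((-1 : k) ^ (maltese n + g - 1) • brace η (mu k N) d n m X a) := by
      intro m n
      rw [smul_comm c]
      rfl
    change diffFun g (c • η) d X a = c • diffFun g η d X a
    unfold diffFun
    rw [sum_congr rfl (fun s hs => sum_congr rfl (h1 s hs)),
      sum_congr rfl (fun m _ => sum_congr rfl (fun n _ => h2 m n))]
    simp only [← smul_sum, ← smul_sub]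

/-- A family, as a function on composable sequences. -/
def evLin (k : Type*) [Field k] (N : ℕ) : Family k N →ₗ[k] Values k N where
  toFun η := ev η
  map_add' _ _ := rfl
  map_smul' _ _ := rfl

/-- Degree `g` `A_∞`-natural transformations `id ⇒ id`: pre-natural transformations `η` with
`μ¹(η) = 0`. -/
def NatTrans (k : Type*) [Field k] (N : ℕ) (g : ℤ) : Submodule k (Family k N) :=
  PreNat k N g ⊓ LinearMap.ker (diff k N g)

/-- Degree `g` coboundaries: the pre-natural transformations of the form `μ¹(θ)`, with `θ` a
pre-natural transformation of degree `g - 1`. -/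
def Cobound (k : Type*) [Field k] (N : ℕ) (g : ℤ) : Submodule k (Family k N) :=
  PreNat k N g ⊓ ((PreNat k N (g - 1)).map (diff k N (g - 1))).comap (evLin k N)

/-- The Hochschild cohomology `HH^g(Δ) = H^g Hom(id, id)`: natural transformations modulo
coboundaries. -/
abbrev HH (k : Type*) [Field k] (N : ℕ) (g : ℤ) : Type _ :=
  NatTrans k N g ⧸ (Cobound k N g).submoduleOf (NatTrans k N g)

/-- The class of a natural transformation in `HH^g(Δ)`. -/
def HH.mk (k : Type*) [Field k] (N : ℕ) (g : ℤ) : NatTrans k N g →ₗ[k] HH k N g :=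
  ((Cobound k N g).submoduleOf (NatTrans k N g)).mkQ

/-! ### The coefficient -/

/-- `ϑ_m` for `m ∈ ℕ`: the parameters are `ϑ_1, …, ϑ_{N-1}`, and `ϑ_0 = ϑ_N = 0`. -/
def param {k : Type*} [Field k] {N : ℕ} (ϑ : Fin (N - 1) → k) (m : ℕ) : k :=
  if h : 1 ≤ m ∧ m < N then ϑ ⟨m - 1, by omega⟩ else 0

/-- The coefficient `ℭ(a_{lj} s^β, a_{ji} s^α)`, which does not depend on `α`, in terms of a sequence
`θ_0, θ_1, …` of scalars. -/
def coeff {k : Type*} [Field k] (θ : ℕ → k) (l j i β : ℕ) : k :=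
  if i < j ∧ j < l then
    -(β * θ j) - ∑ t ∈ Ico 1 (j - i), 2 * β * θ (j - t) - β * θ i
  else if i < l ∧ l ≤ j then
    -(β * θ j) - ∑ t ∈ Icc 1 (j - l), 2 * (β + t) * θ (j - t)
      - ∑ t ∈ Ioo (j - l) (j - i), 2 * (β + (j - l : ℕ)) * θ (j - t)
      - (β + (j - l : ℕ)) * θ i
  else if l ≤ i ∧ i < j then
    -(β * θ j) - ∑ t ∈ Icc 1 (j - i), 2 * (β + t) * θ (j - t) + (β + (j - i : ℕ)) * θ i
  else if l < j ∧ j < i then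
    β * θ j + ∑ t ∈ Ico 1 (i - j), 2 * β * θ (j + t) + β * θ i
  else if j ≤ l ∧ l < i then
    β * θ j + ∑ t ∈ Icc 1 (l - j), 2 * (β + t) * θ (j + t)
      + ∑ t ∈ Ioo (l - j) (i - j), 2 * (β + (l - j : ℕ)) * θ (j + t)
      + (β + (l - j : ℕ)) * θ i
  else if j < i ∧ i ≤ l then
    β * θ j + ∑ t ∈ Icc 1 (i - j), 2 * (β + t) * θ (j + t) - (β + (i - j : ℕ)) * θ i
  else 0

/-- Sliding a black strand that bends to the right. The strand starts at `i`, has its middle at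
`j = i + n` with `β` dots there, and ends at `l`. Sliding the middle across the red strand between `j - 1`
and `j` meets the subpath `s_j^β p_j` and contributes `β (θ_j + θ_{j-1})`. If `l < j`, there is a
`q_{j-1}` above; it contributes another `θ_{j-1}`, and `q_{j-1} p_j = s_{j-1}` is a new dot. -/
def slideRight {k : Type*} [Field k] (θ : ℕ → k) (l i : ℕ) : ℕ → ℕ → k
  | 0, _ => 0
  | n + 1, β =>
    β * (θ (i + n + 1) + θ (i + n)) +
      if l < i + n + 1 then θ (i + n) + slideRight θ l i n (β + 1) else slideRight θ l i n β

/-- Sliding a black strand that bends to the left (the mirror image): the middle is at `j` with `β`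
dots, and `n` red strands are left to cross before the middle reaches the start `i = j + n`. -/
def slideLeft {k : Type*} [Field k] (θ : ℕ → k) (l : ℕ) : ℕ → ℕ → ℕ → k
  | 0, _, _ => 0
  | n + 1, j, β =>
    β * (θ j + θ (j + 1)) +
      if j < l then θ (j + 1) + slideLeft θ l n (j + 1) (β + 1) else slideLeft θ l n (j + 1) β

/-- The sum of all the contributions when the strand diagram of the path `a_{lj} s^β a_{ji} s^α` is
straightened, with a minus sign if the strand bends to the right. -/
def slide {k : Type*} [Field k] (θ : ℕ → k) (l j i β : ℕ) : k :=
  if i < j then -slideRight θ l i (j - i) β else slideLeft θ l (i - j) j β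

end KLRW

end

/-! All morphisms have degree 0, so a degree-2 pre-natural transformation is a single bilinear
component, and `μ¹` on it is the Hochschild differential. Hence `HH²` classifies square-zero
extensions of the category by itself, and coboundaries correspond to split extensions.

Cocycles: once `s` is inverted, the cochain with coefficients `coeff` is the Hochschild coboundary
of the 1-cochain `a_{ji} s^α ↦ primitive θ j i α · a_{ji} s^{α-1}` (`coeff_eq_primitiveCobound`).
The cocycle identity is then `d² = 0` on coefficients (`slideBilin_cocycle`). No negative power
survives, because the coefficient vanishes when `β = δ = 0` (`primitiveCobound_eq_zero`). The
sliding rule computes the same coboundary one red strand at a time.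

Classes: for `N > 0` the category is generated by `p_i : i ⟶ i + 1` and `q_i : i + 1 ⟶ i`, subject
to one relation `p_t q_t = q_{t+1} p_{t+1}` at each of the `N - 1` interior objects; both sides are
the dot. A category containing arrows with these relations composes dotted paths by the same rule
(`dotted_comp_dotted`), so an extension splits as soon as the arrows have lifts satisfying the
relations (`mem_cobound_of_lifts`). The failure of a relation is a polynomial in `s`, and changing
the lift of `q` alters it by multiples of `s`. Only its constant term `relationCoeff` obstructs
(`mem_cobound_of_relationCoeff`), and this term vanishes on coboundaries. On `η_ϑ` it equals `2
ϑ_{t+1}`, so when 2 is invertible the `N - 1` obstructions identify `HH²` with the parameter space.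
-/

open Finset

noncomputable section

namespace KLRW

/-! ### The coefficient as a coboundary, and the sliding rule. -/

section Coefficient

variable {k : Type*} [Field k] (θ : ℕ → k)

/-- The slope `θ_0 + 2 θ_1 + ⋯ + 2 θ_{m-1} + θ_m`. -/
def slope (m : ℕ) : k := ∑ r ∈ range m, (θ r + θ (r + 1))

/-- The partial sums of `slope θ r + θ r`. -/
def slopeSum (m : ℕ) : k := ∑ r ∈ range m, (slope θ r + θ r)

theorem slope_succ (m : ℕ) : slope θ (m + 1) = slope θ m + (θ m + θ (m + 1)) :=
  sum_range_succ _ _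

theorem slopeSum_succ (m : ℕ) : slopeSum θ (m + 1) = slopeSum θ m + (slope θ m + θ m) :=
  sum_range_succ _ _

/-- The coefficient of a primitive of `coeff` over the Laurent polynomials: the value on
`a_{ji} s^α` is `primitive θ j i α` times `a_{ji} s^{α-1}`. -/
def primitive (j i α : ℕ) : k := slopeSum θ (min i j) - slopeSum θ i - α * slope θ i

/-- The coboundary of `primitive`. -/
def primitiveCobound (l j i β : ℕ) : k :=
  primitive θ l j β + primitive θ j i 0 - primitive θ l i (β + delta i j l)

theorem delta_eq (i j l : ℕ) :
    delta i j l = if i ≤ j then (if l ≤ j then min (j - i) (j - l) else 0)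
      else (if j ≤ l then min (i - j) (l - j) else 0) := by
  unfold delta
  have key : 0 ≤ ((i : ℤ) - j) * ((j : ℤ) - l) ↔ (i ≤ j ∧ j ≤ l) ∨ (l ≤ j ∧ j ≤ i) := by
    rw [mul_nonneg_iff]
    omega
  simp only [key]
  split_ifs <;> omega

/-- The exponent of the right factor enters only through `-α * slope θ i`, which depends on the
common source `i` and cancels. Hence the coefficient is independent of `α`. -/
theorem primitive_add (l j i β α : ℕ) :
    primitive θ l j β + primitive θ j i α - primitive θ l i (β + α + delta i j l) =
      primitiveCobound θ l j i β := by
  unfold primitiveCobound primitive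
  push_cast
  ring

/-- Summation by parts: `θ` is integrated once to `slope` and, because of the linear weight `β + t`,
a second time to `slopeSum`. The sums with constant weight need only `slope`. -/
theorem sum_Icc_sub (β j a : ℕ) (h : a ≤ j) :
    ∑ t ∈ Icc 1 a, 2 * ((β : k) + t) * θ (j - t) =
      slopeSum θ j - slopeSum θ (j - a) + β * slope θ j - (β + a) * slope θ (j - a)
        + (β + a) * θ (j - a) - β * θ j := by
  induction a with
  | zero => simp
  | succ a ih =>
    rw [sum_Icc_succ_top (by omega), ih (by omega)]
    obtain ⟨m, rfl⟩ : ∃ m, j = m + (a + 1) := ⟨j - (a + 1), by omega⟩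
    rw [show m + (a + 1) - a = m + 1 by omega, show m + (a + 1) - (a + 1) = m by omega,
      slope_succ, slopeSum_succ]
    push_cast
    ring

theorem sum_Ioo_sub (c : k) (j a n : ℕ) (h : a + n + 1 ≤ j) :
    ∑ t ∈ Ioo a (a + n + 1), 2 * c * θ (j - t) =
      c * (slope θ (j - a) - slope θ (j - (a + n + 1)) - θ (j - a) - θ (j - (a + n + 1))) := by
  induction n with
  | zero =>
    obtain ⟨m, rfl⟩ : ∃ m, j = m + (a + 1) := ⟨j - (a + 1), by omega⟩
    rw [show Ioo a (a + 0 + 1) = ∅ by ext; simp, show m + (a + 1) - a = m + 1 by omega,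
      show m + (a + 1) - (a + 0 + 1) = m by omega, slope_succ]
    simp
  | succ n ih =>
    have e : Ioo a (a + (n + 1) + 1) = insert (a + n + 1) (Ioo a (a + n + 1)) := by
      ext; simp; omega
    rw [e, sum_insert (by simp), ih (by omega)]
    obtain ⟨m, rfl⟩ : ∃ m, j = m + (a + n + 2) := ⟨j - (a + n + 2), by omega⟩
    rw [show m + (a + n + 2) - (a + n + 1) = m + 1 by omega,
      show m + (a + n + 2) - (a + (n + 1) + 1) = m by omega, slope_succ]
    ring

theorem sum_Icc_add (β j a : ℕ) :
    ∑ t ∈ Icc 1 a, 2 * ((β : k) + t) * θ (j + t) =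
      slopeSum θ j - slopeSum θ (j + a) + (β + a) * slope θ (j + a) - β * slope θ j
        + (β + a) * θ (j + a) - β * θ j := by
  induction a with
  | zero => simp
  | succ a ih =>
    rw [sum_Icc_succ_top (by omega), ih, ← add_assoc, slope_succ, slopeSum_succ]
    push_cast
    ring

theorem sum_Ioo_add (c : k) (j a n : ℕ) :
    ∑ t ∈ Ioo a (a + n + 1), 2 * c * θ (j + t) =
      c * (slope θ (j + (a + n + 1)) - slope θ (j + a) - θ (j + a) - θ (j + (a + n + 1))) := by
  induction n with
  | zero =>
    rw [show Ioo a (a + 0 + 1) = ∅ by ext; simp, show j + (a + 0 + 1) = (j + a) + 1 by omega,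
      slope_succ]
    simp
  | succ n ih =>
    have e : Ioo a (a + (n + 1) + 1) = insert (a + n + 1) (Ioo a (a + n + 1)) := by
      ext; simp; omega
    rw [e, sum_insert (by simp), ih, show j + (a + (n + 1) + 1) = j + (a + n + 1) + 1 by omega,
      slope_succ]
    ring

theorem coeff_eq_primitiveCobound (l j i β : ℕ) :
    coeff θ l j i β = primitiveCobound θ l j i β := by
  unfold coeff primitiveCobound primitive
  split_ifs with h1 h2 h3 h4 h5 h6
  · obtain ⟨n, rfl⟩ : ∃ n, j = i + n + 1 := ⟨j - i - 1, by omega⟩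
    have e := sum_Ioo_sub θ (β : k) (i + n + 1) 0 n (by omega)
    -- A strand that does not turn back is the case of zero new dots, `a = 0`, of the
    -- constant-weight sum.
    rw [show Ico 1 (i + n + 1 - i) = Ioo 0 (0 + n + 1) by ext; simp; omega, e, delta_eq,
      if_pos (by omega), if_neg (by omega), show min (i + n + 1) l = i + n + 1 by omega,
      show min i (i + n + 1) = i by omega, show min i l = i by omega,
      show i + n + 1 - (0 + n + 1) = i by omega]
    simp
    ring
  · obtain ⟨n, rfl⟩ : ∃ n, l = i + n + 1 := ⟨l - i - 1, by omega⟩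
    obtain ⟨a, rfl⟩ : ∃ a, j = i + n + 1 + a := ⟨j - (i + n + 1), by omega⟩
    have e := sum_Ioo_sub θ ((β : k) + a) (i + n + 1 + a) a n (by omega)
    rw [show i + n + 1 + a - (i + n + 1) = a by omega, show i + n + 1 + a - i = a + n + 1 by omega,
      e, sum_Icc_sub θ β _ _ (by omega), delta_eq, if_pos (by omega), if_pos (by omega),
      show min (i + n + 1 + a) (i + n + 1) = i + n + 1 by omega,
      show min i (i + n + 1 + a) = i by omega, show min i (i + n + 1) = i by omega,
      show min (i + n + 1 + a - i) (i + n + 1 + a - (i + n + 1)) = a by omega,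
      show i + n + 1 + a - a = i + n + 1 by omega,
      show i + n + 1 + a - (a + n + 1) = i by omega]
    push_cast
    ring
  · rw [sum_Icc_sub θ β _ _ (by omega), delta_eq, if_pos (by omega), if_pos (by omega),
      show min j l = l by omega, show min i j = i by omega, show min i l = l by omega,
      show min (j - i) (j - l) = j - i by omega, show j - (j - i) = i by omega]
    push_cast
    ring
  · obtain ⟨n, rfl⟩ : ∃ n, i = j + n + 1 := ⟨i - j - 1, by omega⟩
    have e := sum_Ioo_add θ (β : k) j 0 n
    rw [show Ico 1 (j + n + 1 - j) = Ioo 0 (0 + n + 1) by ext; simp; omega, e, delta_eq,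
      if_neg (by omega), if_neg (by omega), show min j l = l by omega,
      show min (j + n + 1) j = j by omega, show min (j + n + 1) l = l by omega,
      show j + (0 + n + 1) = j + n + 1 by omega]
    simp
    ring
  · obtain ⟨a, rfl⟩ : ∃ a, l = j + a := ⟨l - j, by omega⟩
    obtain ⟨n, rfl⟩ : ∃ n, i = j + a + n + 1 := ⟨i - (j + a) - 1, by omega⟩
    have e := sum_Ioo_add θ ((β : k) + a) j a n
    rw [show j + a - j = a by omega, show j + a + n + 1 - j = a + n + 1 by omega,
      e, sum_Icc_add θ β, delta_eq, if_neg (by omega), if_pos (by omega),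
      show min j (j + a) = j by omega, show min (j + a + n + 1) j = j by omega,
      show min (j + a + n + 1) (j + a) = j + a by omega,
      show min (j + a + n + 1 - j) (j + a - j) = a by omega,
      show j + (a + n + 1) = j + a + n + 1 by omega]
    push_cast
    ring
  · rw [sum_Icc_add θ β, delta_eq, if_neg (by omega), if_pos (by omega),
      show min j l = j by omega, show min i j = j by omega, show min i l = i by omega,
      show min (i - j) (l - j) = i - j by omega, show j + (i - j) = i by omega]
    push_cast
    ring
  · obtain rfl : i = j := by omega
    rw [delta_eq]
    simp

/-- Lowering the middle by one strand changes the coboundary by exactly the contribution of that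
slide. When the strand turns back, `δ` drops by one while `β` rises by one, so the total `β + δ` in
the third term of the coboundary is unchanged. -/
theorem slideRight_eq (l i n β : ℕ) :
    slideRight θ l i n β = -primitiveCobound θ l (i + n) i β := by
  induction n generalizing β with
  | zero => simp [slideRight, primitiveCobound, primitive, delta_eq]
  | succ n ih =>
    rw [slideRight, ih, ih]
    unfold primitiveCobound primitive
    have e : delta i (i + (n + 1)) l = delta i (i + n) l + if l < i + n + 1 then 1 else 0 := by
      rw [delta_eq, delta_eq]
      split_ifs <;> omega
    rw [e, show min i (i + n) = i by omega, show min i (i + (n + 1)) = i by omega, ← add_assoc]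
    split_ifs with h
    · rw [show min (i + n) l = l by omega, show min (i + n + 1) l = l by omega, slope_succ,
        slopeSum_succ]
      push_cast
      ring
    · rw [show min (i + n) l = i + n by omega, show min (i + n + 1) l = i + n + 1 by omega,
        slope_succ]
      push_cast
      ring

theorem slideLeft_eq (l n j β : ℕ) :
    slideLeft θ l n j β = primitiveCobound θ l j (j + n) β := by
  induction n generalizing j β with
  | zero => simp [slideLeft, primitiveCobound, primitive, delta_eq]
  | succ n ih =>
    rw [slideLeft, ih, ih, show j + 1 + n = j + (n + 1) by omega]
    unfold primitiveCobound primitive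
    have e : delta (j + (n + 1)) j l =
        delta (j + (n + 1)) (j + 1) l + if j < l then 1 else 0 := by
      rw [delta_eq, delta_eq]
      split_ifs <;> omega
    rw [e, show min (j + (n + 1)) j = j by omega, show min (j + (n + 1)) (j + 1) = j + 1 by omega]
    split_ifs with h
    · rw [show min j l = j by omega, show min (j + 1) l = j + 1 by omega,
        slope_succ, slopeSum_succ]
      push_cast
      ring
    · rw [show min j l = l by omega, show min (j + 1) l = l by omega, slope_succ]
      push_cast
      ring

theorem slide_eq_primitiveCobound (l j i β : ℕ) :
    slide θ l j i β = primitiveCobound θ l j i β := by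
  unfold slide
  split_ifs with h
  · rw [slideRight_eq, neg_neg, show i + (j - i) = j by omega]
  · rw [slideLeft_eq, show j + (i - j) = i by omega]

/-- If `δ = 0` then `i, j, l` is monotone, and the three minima collapse. This is what makes the
truncated exponent `β + α + δ - 1` harmless. -/
theorem primitiveCobound_eq_zero {l j i : ℕ} (h : delta i j l = 0) :
    primitiveCobound θ l j i 0 = 0 := by
  unfold primitiveCobound primitive
  rw [h]
  rw [delta_eq] at h
  have : (i ≤ j ∧ j ≤ l) ∨ (l ≤ j ∧ j ≤ i) := by
    split_ifs at h <;> omega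
  rcases this with h | h
  · rw [min_eq_left h.1, min_eq_left h.2, min_eq_left (h.1.trans h.2)]
    simp
  · rw [min_eq_right h.1, min_eq_right h.2, min_eq_right (h.1.trans h.2)]
    simp

/-- The coboundary of `primitive`, as a linear function of the parameters. -/
def primitiveCoboundLin (l j i β : ℕ) : (ℕ → k) →ₗ[k] k where
  toFun θ := primitiveCobound θ l j i β
  map_add' θ θ' := by
    simp only [primitiveCobound, primitive, slopeSum, slope, Pi.add_apply, sum_add_distrib]
    ring
  map_smul' c θ := by
    simp only [primitiveCobound, primitive, slopeSum, slope, Pi.smul_apply, smul_eq_mul,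
      sum_add_distrib, ← mul_sum, RingHom.id_apply]
    ring

end Coefficient

/-! ### Categories with objects `0, 1, 2, …` all of whose morphism sets are the same set -/

/-- A category with objects `0, 1, 2, …` all of whose morphism sets are equal to `M`; `mul l j i x y`
is the composition of `y : i ⟶ j` and `x : j ⟶ l`. -/
structure IndexedCat (M : Type*) where
  /-- the composition -/
  mul : ℕ → ℕ → ℕ → M → M → M
  /-- the identities -/
  one : ℕ → M
  assoc : ∀ n l j i x y z, mul n j i (mul n l j x y) z = mul n l i x (mul l j i y z)
  one_mul : ∀ j i x, mul j j i (one j) x = x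
  mul_one : ∀ j i x, mul j i i x (one i) = x

namespace IndexedCat

variable {M : Type*} (C : IndexedCat M) (p q s : ℕ → M)

/-- The powers of `s_i : i ⟶ i`. -/
def pow (i : ℕ) : ℕ → M
  | 0 => C.one i
  | n + 1 => C.mul i i i (s i) (pow i n)

/-- The composition `i ⟶ i + 1 ⟶ ⋯ ⟶ i + n` of the `p_j : j ⟶ j + 1`. -/
def up (i : ℕ) : ℕ → M
  | 0 => C.one i
  | n + 1 => C.mul (i + n + 1) (i + n) i (p (i + n)) (up i n)

/-- The composition `i + n ⟶ ⋯ ⟶ i + 1 ⟶ i` of the `q_j : j + 1 ⟶ j`. -/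
def down (i : ℕ) : ℕ → M
  | 0 => C.one i
  | n + 1 => C.mul i (i + n) (i + n + 1) (down i n) (q (i + n))

/-- The shortest composition `i ⟶ j`. -/
def path (j i : ℕ) : M := if i ≤ j then C.up p i (j - i) else C.down q j (i - j)

/-- The shortest composition `i ⟶ j`, with `α` dots. -/
def dotted (j i α : ℕ) : M := C.mul j i i (C.path p q j i) (C.pow s i α)

theorem pow_add (i m n : ℕ) : C.mul i i i (C.pow s i m) (C.pow s i n) = C.pow s i (m + n) := by
  induction m with
  | zero => simp [pow, C.one_mul]
  | succ m ih => rw [pow, C.assoc, ih, Nat.add_right_comm, pow]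

theorem pow_one (i : ℕ) : C.pow s i 1 = s i := by
  rw [pow, pow, C.mul_one]

/-- `up` grows at its target; here it grows at its source, as needed to absorb arrows from the
right. -/
theorem up_comp (i n : ℕ) :
    C.mul (i + (n + 1)) (i + 1) i (C.up p (i + 1) n) (p i) = C.up p i (n + 1) := by
  induction n with
  | zero => simp [up, C.one_mul, C.mul_one]
  | succ n ih =>
    rw [up, up, ← ih, show i + 1 + n = i + (n + 1) by omega,
      show i + (n + 1 + 1) = i + (n + 1) + 1 by omega, C.assoc]

theorem comp_down (i n : ℕ) :
    C.mul i (i + 1) (i + (n + 1)) (q i) (C.down q (i + 1) n) = C.down q i (n + 1) := by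
  induction n with
  | zero => simp [down, C.one_mul, C.mul_one]
  | succ n ih =>
    rw [down, down, ← ih, show i + 1 + n = i + (n + 1) by omega,
      show i + (n + 1 + 1) = i + (n + 1) + 1 by omega, C.assoc]

theorem path_comp_p {l j : ℕ} (h : j < l) :
    C.mul l (j + 1) j (C.path p q l (j + 1)) (p j) = C.path p q l j := by
  obtain ⟨n, rfl⟩ : ∃ n, l = j + (n + 1) := ⟨l - (j + 1), by omega⟩
  rw [path, path, if_pos (by omega), if_pos (by omega), show j + (n + 1) - (j + 1) = n by omega,
    show j + (n + 1) - j = n + 1 by omega, up_comp]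

theorem path_comp_q {l j : ℕ} (h : l ≤ j) :
    C.mul l j (j + 1) (C.path p q l j) (q j) = C.path p q l (j + 1) := by
  obtain ⟨n, rfl⟩ : ∃ n, j = l + n := ⟨j - l, by omega⟩
  have e : C.path p q l (l + n) = C.down q l n := by
    rw [path]
    split_ifs with h
    · obtain rfl : n = 0 := by omega
      simp [up, down]
    · rw [show l + n - l = n by omega]
  rw [e, path, if_neg (by omega), show l + n + 1 - l = n + 1 by omega, down]

variable {C p q s} {N : ℕ}

/-- The path to `l` starts with `q_j`, which meets `p_j` and leaves a dot. -/
theorem path_comp_p'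
    (hqp : ∀ i < N, C.mul i (i + 1) i (q i) (p i) = s i)
    {l j : ℕ} (h : l ≤ j) (hj : j < N) :
    C.mul l (j + 1) j (C.path p q l (j + 1)) (p j) = C.mul l j j (C.path p q l j) (s j) := by
  rw [← path_comp_q C p q h, C.assoc, hqp j hj]

theorem path_comp_q'
    (hpq : ∀ i < N, C.mul (i + 1) i (i + 1) (p i) (q i) = s (i + 1))
    {l j : ℕ} (h : j < l) (hj : j < N) :
    C.mul l j (j + 1) (C.path p q l j) (q j) =
      C.mul l (j + 1) (j + 1) (C.path p q l (j + 1)) (s (j + 1)) := by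
  rw [← path_comp_p C p q h, C.assoc, hpq j hj]

/-- Both sides are `p_i q_i p_i`, so dots slide along arrows. -/
theorem s_comp_p
    (hqp : ∀ i < N, C.mul i (i + 1) i (q i) (p i) = s i)
    (hpq : ∀ i < N, C.mul (i + 1) i (i + 1) (p i) (q i) = s (i + 1))
    {i : ℕ} (h : i < N) :
    C.mul (i + 1) (i + 1) i (s (i + 1)) (p i) = C.mul (i + 1) i i (p i) (s i) := by
  rw [← hqp i h, ← hpq i h, C.assoc]

theorem s_comp_q
    (hqp : ∀ i < N, C.mul i (i + 1) i (q i) (p i) = s i)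
    (hpq : ∀ i < N, C.mul (i + 1) i (i + 1) (p i) (q i) = s (i + 1))
    {i : ℕ} (h : i < N) :
    C.mul i i (i + 1) (s i) (q i) = C.mul i (i + 1) (i + 1) (q i) (s (i + 1)) := by
  rw [← hqp i h, ← hpq i h, C.assoc]

theorem s_comp_up
    (hqp : ∀ i < N, C.mul i (i + 1) i (q i) (p i) = s i)
    (hpq : ∀ i < N, C.mul (i + 1) i (i + 1) (p i) (q i) = s (i + 1))
    (i n : ℕ) (h : i + n ≤ N) :
    C.mul (i + n) (i + n) i (s (i + n)) (C.up p i n) = C.mul (i + n) i i (C.up p i n) (s i) := by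
  induction n with
  | zero => simp [up, C.one_mul, C.mul_one]
  | succ n ih =>
    rw [up, ← add_assoc, ← C.assoc, s_comp_p hqp hpq (by omega), C.assoc, ih (by omega), C.assoc]

theorem s_comp_down
    (hqp : ∀ i < N, C.mul i (i + 1) i (q i) (p i) = s i)
    (hpq : ∀ i < N, C.mul (i + 1) i (i + 1) (p i) (q i) = s (i + 1))
    (i n : ℕ) (h : i + n ≤ N) :
    C.mul i i (i + n) (s i) (C.down q i n) =
      C.mul i (i + n) (i + n) (C.down q i n) (s (i + n)) := by
  induction n with
  | zero => simp [down, C.one_mul, C.mul_one]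
  | succ n ih =>
    rw [down, ← add_assoc, C.assoc, ← s_comp_q hqp hpq (by omega), ← C.assoc, ih (by omega),
      C.assoc]

theorem s_comp_path
    (hqp : ∀ i < N, C.mul i (i + 1) i (q i) (p i) = s i)
    (hpq : ∀ i < N, C.mul (i + 1) i (i + 1) (p i) (q i) = s (i + 1))
    {j i : ℕ} (hj : j ≤ N) (hi : i ≤ N) :
    C.mul j j i (s j) (C.path p q j i) = C.mul j i i (C.path p q j i) (s i) := by
  unfold path
  split_ifs with h
  · have := s_comp_up hqp hpq i (j - i) (by omega)
    rwa [show i + (j - i) = j by omega] at this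
  · have := s_comp_down hqp hpq j (i - j) (by omega)
    rwa [show j + (i - j) = i by omega] at this

theorem pow_comp_path
    (hqp : ∀ i < N, C.mul i (i + 1) i (q i) (p i) = s i)
    (hpq : ∀ i < N, C.mul (i + 1) i (i + 1) (p i) (q i) = s (i + 1))
    {j i : ℕ} (hj : j ≤ N) (hi : i ≤ N) (n : ℕ) :
    C.mul j j i (C.pow s j n) (C.path p q j i) = C.mul j i i (C.path p q j i) (C.pow s i n) := by
  induction n with
  | zero => simp [pow, C.one_mul, C.mul_one]
  | succ n ih =>
    rw [pow, pow, C.assoc, ih, ← C.assoc, s_comp_path hqp hpq hj hi, C.assoc]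

/-- The arrows of the lower path are absorbed one at a time. Each either lies on the shortest path
to `l`, or backtracks and leaves a dot, which is slid down to the source; `δ` counts the backtracks.
-/
theorem path_comp_up
    (hqp : ∀ i < N, C.mul i (i + 1) i (q i) (p i) = s i)
    (hpq : ∀ i < N, C.mul (i + 1) i (i + 1) (p i) (q i) = s (i + 1))
    {l i : ℕ} (n : ℕ) (h : i + n ≤ N) :
    C.mul l (i + n) i (C.path p q l (i + n)) (C.up p i n) =
      C.mul l i i (C.path p q l i) (C.pow s i (delta i (i + n) l)) := by
  induction n with
  | zero => simp [up, delta, pow]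
  | succ n ih =>
    rw [up, ← add_assoc, ← C.assoc]
    by_cases hl : i + n < l
    · rw [path_comp_p _ _ _ hl, ih (by omega)]
      congr 2
      rw [delta_eq, delta_eq]
      split_ifs <;> omega
    · rw [path_comp_p' hqp (by omega) (by omega), C.assoc, s_comp_up hqp hpq _ _ (by omega),
        ← C.assoc, ih (by omega), C.assoc, ← pow_one C s i, pow_add]
      congr 2
      rw [delta_eq, delta_eq]
      split_ifs <;> omega

/-- Arrows are peeled off at the target `j`, which moves during the induction while the source `j +
n` stays fixed. -/
theorem path_comp_down
    (hqp : ∀ i < N, C.mul i (i + 1) i (q i) (p i) = s i)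
    (hpq : ∀ i < N, C.mul (i + 1) i (i + 1) (p i) (q i) = s (i + 1))
    {l : ℕ} (j n : ℕ) (h : j + n ≤ N) :
    C.mul l j (j + n) (C.path p q l j) (C.down q j n) =
      C.mul l (j + n) (j + n) (C.path p q l (j + n)) (C.pow s (j + n) (delta (j + n) j l)) := by
  induction n generalizing j with
  | zero => simp [down, delta, pow]
  | succ n ih =>
    have e := ih (j + 1) (by omega)
    rw [show j + 1 + n = j + (n + 1) by omega] at e
    rw [← comp_down, ← C.assoc]
    by_cases hl : j < l
    · have e' := s_comp_down hqp hpq (j + 1) n (by omega)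
      rw [show j + 1 + n = j + (n + 1) by omega] at e'
      rw [path_comp_q' hpq hl (by omega), C.assoc, e', ← C.assoc, e, C.assoc,
        ← pow_one C s (j + (n + 1)), pow_add]
      congr 2
      rw [delta_eq, delta_eq]
      split_ifs <;> omega
    · rw [path_comp_q _ _ _ (by omega), e]
      congr 2
      rw [delta_eq, delta_eq]
      split_ifs <;> omega

theorem path_comp_path
    (hqp : ∀ i < N, C.mul i (i + 1) i (q i) (p i) = s i)
    (hpq : ∀ i < N, C.mul (i + 1) i (i + 1) (p i) (q i) = s (i + 1))
    {l j i : ℕ} (hj : j ≤ N) (hi : i ≤ N) :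
    C.mul l j i (C.path p q l j) (C.path p q j i) =
      C.mul l i i (C.path p q l i) (C.pow s i (delta i j l)) := by
  conv_lhs => arg 6; unfold path
  split_ifs with h
  · have := path_comp_up (l := l) hqp hpq (i := i) (j - i) (by omega)
    rwa [show i + (j - i) = j by omega] at this
  · have := path_comp_down (l := l) hqp hpq j (i - j) (by omega)
    rwa [show j + (i - j) = i by omega] at this

theorem dotted_comp_dotted
    (hqp : ∀ i < N, C.mul i (i + 1) i (q i) (p i) = s i)
    (hpq : ∀ i < N, C.mul (i + 1) i (i + 1) (p i) (q i) = s (i + 1))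
    {l j i : ℕ} (hj : j ≤ N) (hi : i ≤ N) (β α : ℕ) :
    C.mul l j i (C.dotted p q s l j β) (C.dotted p q s j i α) =
      C.dotted p q s l i (β + α + delta i j l) := by
  unfold dotted
  rw [C.assoc, ← C.assoc j j i i, pow_comp_path hqp hpq hj hi, C.assoc, pow_add, ← C.assoc,
    path_comp_path hqp hpq hj hi, C.assoc, pow_add, add_comm (delta i j l)]

end IndexedCat

/-! ### Reduction to Hochschild 1- and 2-cochains. -/

section Plumbing

variable {k : Type*} [Field k] {N : ℕ}

/-- Every morphism space has the carrier `ℕ →₀ k`, so values at equal sequences of objects are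
compared without transport. -/
theorem family_congr (η : Family k N) (d : ℕ) {X Y : Fin (d + 1) → Ob N} (h : X = Y)
    {a b : Fin d → ℕ →₀ k} (hab : a = b) : (η d X a : ℕ →₀ k) = η d Y b := by
  subst h hab
  rfl

/-- The bilinear map `η²` on `Hom(T_j, T_l) × Hom(T_i, T_j)`. -/
def val₂ (η : Family k N) (i j l : Ob N) : (ℕ →₀ k) →ₗ[k] (ℕ →₀ k) →ₗ[k] (ℕ →₀ k) :=
  LinearMap.mk₂ k (fun y x => η 2 ![i, j, l] (![x, y] : Fin 2 → ℕ →₀ k))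
    (fun y y' x => by
      have h := (η 2 ![i, j, l]).map_update_add (![x, 0] : Fin 2 → ℕ →₀ k) 1 y y'
      have e : ∀ z : ℕ →₀ k, Function.update
          (β := fun p : Fin 2 => Mor k (![i, j, l] p.castSucc) (![i, j, l] p.succ))
          (![x, 0] : Fin 2 → ℕ →₀ k) 1 z = (![x, z] : Fin 2 → ℕ →₀ k) := by
        intro z
        funext p
        fin_cases p <;> rfl
      rw [e, e, e] at h
      exact h)
    (fun c y x => by
      have h := (η 2 ![i, j, l]).map_update_smul (![x, 0] : Fin 2 → ℕ →₀ k) 1 c y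
      have e : ∀ z : ℕ →₀ k, Function.update
          (β := fun p : Fin 2 => Mor k (![i, j, l] p.castSucc) (![i, j, l] p.succ))
          (![x, 0] : Fin 2 → ℕ →₀ k) 1 z = (![x, z] : Fin 2 → ℕ →₀ k) := by
        intro z
        funext p
        fin_cases p <;> rfl
      rw [e, e] at h
      exact h)
    (fun y x x' => by
      have h := (η 2 ![i, j, l]).map_update_add (![0, y] : Fin 2 → ℕ →₀ k) 0 x x'
      have e : ∀ z : ℕ →₀ k, Function.update
          (β := fun p : Fin 2 => Mor k (![i, j, l] p.castSucc) (![i, j, l] p.succ))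
          (![0, y] : Fin 2 → ℕ →₀ k) 0 z = (![z, y] : Fin 2 → ℕ →₀ k) := by
        intro z
        funext p
        fin_cases p <;> rfl
      rw [e, e, e] at h
      exact h)
    (fun c y x => by
      have h := (η 2 ![i, j, l]).map_update_smul (![0, y] : Fin 2 → ℕ →₀ k) 0 c x
      have e : ∀ z : ℕ →₀ k, Function.update
          (β := fun p : Fin 2 => Mor k (![i, j, l] p.castSucc) (![i, j, l] p.succ))
          (![0, y] : Fin 2 → ℕ →₀ k) 0 z = (![z, y] : Fin 2 → ℕ →₀ k) := by
        intro z
        funext p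
        fin_cases p <;> rfl
      rw [e, e] at h
      exact h)

/-- The linear map `θ¹` on `Hom(T_i, T_j)`. -/
def val₁ (θ : Family k N) (i j : Ob N) : (ℕ →₀ k) →ₗ[k] (ℕ →₀ k) where
  toFun x := θ 1 ![i, j] (fun _ => x)
  map_add' x x' := by
    have h := (θ 1 ![i, j]).map_update_add (fun _ => (0 : ℕ →₀ k)) 0 x x'
    have e : ∀ z : ℕ →₀ k, Function.update
        (β := fun p : Fin 1 => Mor k (![i, j] p.castSucc) (![i, j] p.succ))
        (fun _ => (0 : ℕ →₀ k)) 0 z = (fun _ => z) := by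
      intro z
      funext p
      fin_cases p
      rfl
    rw [e, e, e] at h
    exact h
  map_smul' c x := by
    have h := (θ 1 ![i, j]).map_update_smul (fun _ => (0 : ℕ →₀ k)) 0 c x
    have e : ∀ z : ℕ →₀ k, Function.update
        (β := fun p : Fin 1 => Mor k (![i, j] p.castSucc) (![i, j] p.succ))
        (fun _ => (0 : ℕ →₀ k)) 0 z = (fun _ => z) := by
      intro z
      funext p
      fin_cases p
      rfl
    rw [e, e] at h
    exact h

theorem ev_two (η : Family k N) (X : ℕ → Ob N) (a : ∀ p, Mor k (X p) (X (p + 1))) :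
    ev η 2 X a = val₂ η (X 0) (X 1) (X 2) (a 1) (a 0) := by
  refine family_congr η 2 ?_ ?_
  · funext p
    fin_cases p <;> rfl
  · funext p
    fin_cases p <;> rfl

theorem ev_one (η : Family k N) (X : ℕ → Ob N) (a : ∀ p, Mor k (X p) (X (p + 1))) :
    ev η 1 X a = val₁ η (X 0) (X 1) (a 0) := by
  refine family_congr η 1 ?_ ?_
  · funext p
    fin_cases p <;> rfl
  · funext p
    fin_cases p
    rfl

/-- `η` has only the component `η^g`. -/
def Supported (η : Family k N) (g : ℕ) : Prop := ∀ d, d ≠ g → η d = 0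

theorem mu_supported : Supported (mu k N) 2 := by
  intro d hd
  match d, hd with
  | 0, _ => rfl
  | 1, _ => rfl
  | 2, h => exact absurd rfl h
  | _ + 3, _ => rfl

theorem Supported.ev_eq_zero {η : Family k N} {g : ℕ} (h : Supported η g) {d : ℕ} (hd : d ≠ g)
    (X : ℕ → Ob N) (a : ∀ p, Mor k (X p) (X (p + 1))) : ev η d X a = 0 := by
  unfold ev
  rw [h d hd]
  rfl

/-- On morphisms of degree 0 the output of `η^d` has degree `g - d`, and only degree 0 is nonzero.
-/
theorem mem_preNat_iff (η : Family k N) (g : ℕ) : η ∈ PreNat k N g ↔ Supported η g := by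
  constructor
  · intro h d hd
    funext X
    ext1 a
    have := h d X 0 a (fun p => by simp [degPart])
    have hne : ((g : ℤ) - d) ≠ 0 := by omega
    simpa [degPart, hne] using this
  · intro h d X e a ha
    by_cases hd : d = g
    · subst hd
      by_cases he : ∀ p, e p = 0
      · simp [degPart, he]
      · push Not at he
        obtain ⟨p, hp⟩ := he
        have h0 : a p = 0 := by simpa [degPart, hp] using ha p
        rw [MultilinearMap.map_coord_zero _ p h0]
        exact Submodule.zero_mem _
    · rw [h d hd]
      exact Submodule.zero_mem _

theorem brace_eq_zero {η ζ : Family k N} {u v : ℕ} (hη : Supported η u) (hζ : Supported ζ v)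
    {d n s : ℕ} (hn : n < d - s + 1) (h : ¬(s = v ∧ d - s + 1 = u)) (X : ℕ → Ob N)
    (a : ∀ p, Mor k (X p) (X (p + 1))) : brace η ζ d n s X a = 0 := by
  by_cases hs : s = v
  · exact hη.ev_eq_zero (fun e => h ⟨hs, e⟩) _ _
  · have e : evFrom ζ n s X a = 0 := hζ.ev_eq_zero hs _ _
    unfold brace
    rw [e]
    exact MultilinearMap.map_coord_zero _ (⟨n, hn⟩ : Fin (d - s + 1)) (by simp [contractMor])

theorem diffFun_eq_zero {η : Family k N} {g : ℕ} (h : Supported η g) {d : ℕ} (hd : d ≠ g + 1)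
    (X : ℕ → Ob N) (a : ∀ p, Mor k (X p) (X (p + 1))) : diffFun g η d X a = 0 := by
  unfold diffFun
  rw [sum_eq_zero, sum_eq_zero, sub_zero]
  · intro s hs
    refine sum_eq_zero fun n hn => ?_
    rw [mem_range] at hs hn
    rw [brace_eq_zero h mu_supported hn (by omega), smul_zero]
  · intro s hs
    refine sum_eq_zero fun n hn => ?_
    rw [mem_range] at hs hn
    rw [brace_eq_zero mu_supported h hn (by omega), smul_zero]

/-- Since `η` and `μ` are both purely binary, only insertions with `s = 2` or `m = 2` at positions
`n = 0, 1` survive. -/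
theorem diffFun_two {η : Family k N} (h : Supported η 2) (X : ℕ → Ob N)
    (a : ∀ p, Mor k (X p) (X (p + 1))) :
    diffFun 2 η 3 X a =
      comp k (X 0) (X 2) (X 3) (a 2) (val₂ η (X 0) (X 1) (X 2) (a 1) (a 0))
      - comp k (X 0) (X 1) (X 3) (val₂ η (X 1) (X 2) (X 3) (a 2) (a 1)) (a 0)
      + val₂ η (X 0) (X 2) (X 3) (a 2) (comp k (X 0) (X 1) (X 2) (a 1) (a 0))
      - val₂ η (X 0) (X 1) (X 3) (comp k (X 1) (X 2) (X 3) (a 2) (a 1)) (a 0) := by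
  have e1 : brace (mu k N) η 3 0 2 X a =
      comp k (X 0) (X 2) (X 3) (a 2) (val₂ η (X 0) (X 1) (X 2) (a 1) (a 0)) := by
    exact congrArg (comp k (X 0) (X 2) (X 3) (a 2))
      (ev_two η (fun p => X (0 + p)) (fun p => a (0 + p)))
  have e2 : brace (mu k N) η 3 1 2 X a =
      comp k (X 0) (X 1) (X 3) (val₂ η (X 1) (X 2) (X 3) (a 2) (a 1)) (a 0) := by
    rw [← ev_two η (fun p => X (1 + p)) (fun p => a (1 + p))]
    rfl
  have e3 : brace η (mu k N) 3 0 2 X a =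
      val₂ η (X 0) (X 2) (X 3) (a 2) (comp k (X 0) (X 1) (X 2) (a 1) (a 0)) := by
    exact ev_two η _ _
  have e4 : brace η (mu k N) 3 1 2 X a =
      val₂ η (X 0) (X 1) (X 3) (comp k (X 1) (X 2) (X 3) (a 2) (a 1)) (a 0) := by
    exact ev_two η _ _
  unfold diffFun
  refine (congrArg₂ (· - ·) (sum_eq_single 2 ?_ ?_) (sum_eq_single 2 ?_ ?_)).trans ?_
  rotate_left 4
  · rw [show 3 - 2 + 1 = 2 from rfl]
    simp only [sum_range_succ, sum_range_zero, zero_add, e1, e2, e3, e4, maltese]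
    norm_num
    abel
  all_goals
    first
    | (intro s hs hs2
       refine sum_eq_zero fun n hn => ?_
       rw [mem_range] at hn
       first
       | rw [brace_eq_zero h mu_supported hn (by omega), smul_zero]
       | rw [brace_eq_zero mu_supported h hn (by omega), smul_zero])
    | (intro h
       simp at h)

theorem diffFun_one {η : Family k N} (h : Supported η 1) (X : ℕ → Ob N)
    (a : ∀ p, Mor k (X p) (X (p + 1))) :
    diffFun 1 η 2 X a =
      comp k (X 0) (X 1) (X 2) (a 1) (val₁ η (X 0) (X 1) (a 0))
      + comp k (X 0) (X 1) (X 2) (val₁ η (X 1) (X 2) (a 1)) (a 0)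
      - val₁ η (X 0) (X 2) (comp k (X 0) (X 1) (X 2) (a 1) (a 0)) := by
  have e1 : brace (mu k N) η 2 0 1 X a =
      comp k (X 0) (X 1) (X 2) (a 1) (val₁ η (X 0) (X 1) (a 0)) := by
    exact congrArg (comp k (X 0) (X 1) (X 2) (a 1))
      (ev_one η (fun p => X (0 + p)) (fun p => a (0 + p)))
  have e2 : brace (mu k N) η 2 1 1 X a =
      comp k (X 0) (X 1) (X 2) (val₁ η (X 1) (X 2) (a 1)) (a 0) := by
    rw [← ev_one η (fun p => X (1 + p)) (fun p => a (1 + p))]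
    rfl
  have e3 : brace η (mu k N) 2 0 2 X a =
      val₁ η (X 0) (X 2) (comp k (X 0) (X 1) (X 2) (a 1) (a 0)) := by
    exact ev_one η _ _
  unfold diffFun
  refine (congrArg₂ (· - ·) (sum_eq_single 1 ?_ ?_) (sum_eq_single 2 ?_ ?_)).trans ?_
  rotate_left 4
  · rw [show 2 - 1 + 1 = 2 from rfl, show 2 - 2 + 1 = 1 from rfl]
    simp only [sum_range_succ, sum_range_zero, zero_add, e1, e2, e3, maltese]
    norm_num
  all_goals
    first
    | (intro s hs hs2
       refine sum_eq_zero fun n hn => ?_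
       rw [mem_range] at hn
       first
       | rw [brace_eq_zero h mu_supported hn (by omega), smul_zero]
       | rw [brace_eq_zero mu_supported h hn (by omega), smul_zero])
    | (intro h
       simp at h)

/-- The family with a given bilinear `η²` and no other components. -/
def ofBilin (F : ∀ _ _ _ : Ob N, (ℕ →₀ k) →ₗ[k] (ℕ →₀ k) →ₗ[k] (ℕ →₀ k)) : Family k N
  | 2, X =>
    { toFun := fun a => F (X 0) (X 1) (X 2) (a 1) (a 0)
      map_update_add' := by
        intro _ m p x y
        fin_cases p <;> simp [Function.update]
      map_update_smul' := by
        intro _ m p c x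
        fin_cases p <;> simp [Function.update] }
  | _, _ => 0

theorem ofBilin_supported (F : ∀ _ _ _ : Ob N, (ℕ →₀ k) →ₗ[k] (ℕ →₀ k) →ₗ[k] (ℕ →₀ k)) :
    Supported (ofBilin F) 2 := by
  intro d hd
  match d, hd with
  | 0, _ => rfl
  | 1, _ => rfl
  | 2, h => exact absurd rfl h
  | _ + 3, _ => rfl

/-- The family with a given linear `θ¹` and no other components. -/
def ofLin (F : ∀ _ _ : Ob N, (ℕ →₀ k) →ₗ[k] (ℕ →₀ k)) : Family k N
  | 1, X =>
    { toFun := fun a => F (X 0) (X 1) (a 0)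
      map_update_add' := by
        intro _ m p x y
        fin_cases p
        simp [Function.update]
      map_update_smul' := by
        intro _ m p c x
        fin_cases p
        simp [Function.update] }
  | _, _ => 0

theorem ofLin_supported (F : ∀ _ _ : Ob N, (ℕ →₀ k) →ₗ[k] (ℕ →₀ k)) :
    Supported (ofLin F) 1 := by
  intro d hd
  match d, hd with
  | 0, _ => rfl
  | 1, h => exact absurd rfl h
  | _ + 2, _ => rfl

theorem Supported.ext_val₂ {η ζ : Family k N} (hη : Supported η 2) (hζ : Supported ζ 2)
    (h : ∀ i j l, val₂ η i j l = val₂ ζ i j l) : η = ζ := by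
  funext d X
  by_cases hd : d = 2
  · subst hd
    ext1 a
    have e : ∀ ξ : Family k N, ξ 2 X a = val₂ ξ (X 0) (X 1) (X 2) (a 1) (a 0) := by
      intro ξ
      refine family_congr ξ 2 ?_ ?_
      · funext p
        fin_cases p <;> rfl
      · funext p
        fin_cases p <;> rfl
    rw [e, e, h]
  · rw [hη d hd, hζ d hd]

/-- A composable sequence that starts with three given morphisms. -/
theorem exists_composable (k : Type*) [Field k] {N : ℕ} (i j l n : Ob N) (x y z : ℕ →₀ k) :
    ∃ (X : ℕ → Ob N) (a : ∀ p, Mor k (X p) (X (p + 1))),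
      X 0 = i ∧ X 1 = j ∧ X 2 = l ∧ X 3 = n ∧ a 0 = x ∧ a 1 = y ∧ a 2 = z :=
  ⟨fun p => if p = 0 then i else if p = 1 then j else if p = 2 then l else n,
    fun p => if p = 0 then x else if p = 1 then y else z, by simp⟩

theorem mem_natTrans_iff (η : Family k N) :
    η ∈ NatTrans k N 2 ↔ Supported η 2 ∧ ∀ (i j l n : Ob N) (x y z : ℕ →₀ k),
      comp k i l n z (val₂ η i j l y x) - comp k i j n (val₂ η j l n z y) x
        + val₂ η i l n z (comp k i j l y x) - val₂ η i j n (comp k j l n z y) x = 0 := by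
  have hp : η ∈ PreNat k N 2 ↔ Supported η 2 := mem_preNat_iff η 2
  rw [NatTrans, Submodule.mem_inf, hp, LinearMap.mem_ker]
  refine and_congr_right fun h => ⟨fun hd i j l n x y z => ?_, fun hd => ?_⟩
  · obtain ⟨X, a, rfl, rfl, rfl, rfl, rfl, rfl, rfl⟩ := exists_composable k i j l n x y z
    rw [← diffFun_two h X a]
    exact congrFun (congrFun (congrFun hd 3) X) a
  · funext d X a
    by_cases h3 : d = 3
    · subst h3
      exact (diffFun_two h X a).trans (hd _ _ _ _ _ _ _)
    · exact diffFun_eq_zero h h3 X a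

theorem mem_cobound_iff {η : Family k N} (hη : Supported η 2) :
    η ∈ Cobound k N 2 ↔ ∃ θ : ∀ _ _ : Ob N, (ℕ →₀ k) →ₗ[k] (ℕ →₀ k),
      ∀ (i j l : Ob N) (x y : ℕ →₀ k), val₂ η i j l y x =
        comp k i j l y (θ i j x) + comp k i j l (θ j l y) x - θ i l (comp k i j l y x) := by
  have hp : η ∈ PreNat k N 2 := (mem_preNat_iff η 2).2 hη
  constructor
  · rintro ⟨-, θ, hθ, h⟩
    have hθ' : Supported θ 1 := (mem_preNat_iff θ 1).1 (by simpa using hθ)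
    refine ⟨val₁ θ, fun i j l x y => ?_⟩
    obtain ⟨X, a, rfl, rfl, rfl, -, rfl, rfl, -⟩ := exists_composable k i j l l x y 0
    rw [← diffFun_one hθ' X a, ← ev_two η X a]
    exact (congrFun (congrFun (congrFun h 2) X) a).symm
  · rintro ⟨θ, h⟩
    refine ⟨hp, ofLin θ, ?_, ?_⟩
    · exact (mem_preNat_iff _ 1).2 (ofLin_supported θ)
    · funext d X a
      by_cases h2 : d = 2
      · subst h2
        refine (diffFun_one (ofLin_supported θ) X a).trans ?_
        refine Eq.trans ?_ (ev_two η X a).symm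
        rw [h]
        rfl
      · refine (diffFun_eq_zero (ofLin_supported θ) h2 X a).trans ?_
        exact (hη.ev_eq_zero h2 X a).symm

end Plumbing

/-! ### Associativity, units and divisibility by `s`. -/

section Composition

variable {k : Type*} [Field k] {N : ℕ}

/-- With truncated subtraction, `δ` is the coboundary of the positive part of `i - j`; its cocycle
identity, and hence associativity, follow formally. -/
theorem delta_add (i j l : ℕ) : delta i j l + (i - l) = (i - j) + (j - l) := by
  rw [delta_eq]
  split_ifs <;> omega

theorem delta_cocycle (i j l n : ℕ) :
    delta i j l + delta i l n = delta j l n + delta i j n := by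
  have h1 := delta_add i j l
  have h2 := delta_add i l n
  have h3 := delta_add j l n
  have h4 := delta_add i j n
  omega

theorem comp_single (i j l : Ob N) (β α : ℕ) (b a : k) :
    comp k i j l (Finsupp.single β b) (Finsupp.single α a) =
      Finsupp.single (β + α + delta i j l) (b * a) := by
  simp [comp]

theorem comp_one_left (i j l : Ob N) (x : ℕ →₀ k) :
    comp k i j l (Finsupp.single 0 1) x = Finsupp.mapDomain (· + delta i j l) x := by
  simp [comp, Finsupp.lmapDomain]

theorem comp_one_right (i j l : Ob N) (x : ℕ →₀ k) :
    comp k i j l x (Finsupp.single 0 1) = Finsupp.mapDomain (· + delta i j l) x := by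
  induction x using Finsupp.induction_linear with
  | zero => simp
  | add x x' h h' => rw [map_add, LinearMap.add_apply, h, h', Finsupp.mapDomain_add]
  | single β b => rw [comp_single, Finsupp.mapDomain_single, mul_one, add_zero]

theorem comp_id_left (i j : Ob N) (x : ℕ →₀ k) :
    comp k i j j (Finsupp.single 0 1) x = x := by
  rw [comp_one_left, show delta i j j = 0 by rw [delta_eq]; split_ifs <;> omega]
  exact Finsupp.mapDomain_id

theorem comp_id_right (i j : Ob N) (x : ℕ →₀ k) :
    comp k i i j x (Finsupp.single 0 1) = x := by
  rw [comp_one_right, show delta i i j = 0 by rw [delta_eq]; split_ifs <;> omega]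
  exact Finsupp.mapDomain_id

theorem comp_assoc (i j l n : Ob N) (x y z : ℕ →₀ k) :
    comp k i j n (comp k j l n z y) x = comp k i l n z (comp k i j l y x) := by
  induction z using Finsupp.induction_linear with
  | zero => simp
  | add z z' h h' => simp only [map_add, LinearMap.add_apply, h, h']
  | single γ c =>
  induction y using Finsupp.induction_linear with
  | zero => simp
  | add y y' h h' => simp only [map_add, LinearMap.add_apply, h, h']
  | single β b =>
  induction x using Finsupp.induction_linear with
  | zero => simp
  | add x x' h h' => simp only [map_add, h, h']
  | single α a =>
  simp only [comp_single, mul_assoc]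
  congr 1
  have := delta_cocycle i j l n
  omega

theorem comp_apply_zero {i j l : Ob N} (h : delta i j l ≠ 0) (y x : ℕ →₀ k) :
    comp k i j l y x 0 = 0 := by
  induction y using Finsupp.induction_linear with
  | zero => simp
  | add y y' h h' => rw [map_add, LinearMap.add_apply, Finsupp.add_apply, h, h', add_zero]
  | single β b =>
  induction x using Finsupp.induction_linear with
  | zero => simp
  | add x x' h h' => rw [map_add, Finsupp.add_apply, h, h', add_zero]
  | single α a =>
  rw [comp_single, Finsupp.single_eq_of_ne (by omega)]

theorem exists_mapDomain_add_one (g : ℕ →₀ k) (h : g 0 = 0) :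
    ∃ g' : ℕ →₀ k, Finsupp.mapDomain (· + 1) g' = g := by
  have hinj : Function.Injective (fun n : ℕ => n + 1) := add_left_injective 1
  refine ⟨Finsupp.comapDomain (· + 1) g hinj.injOn, Finsupp.mapDomain_comapDomain _ hinj g ?_⟩
  intro n hn
  cases n with
  | zero => simp [h] at hn
  | succ n => exact ⟨n, rfl⟩

end Composition

/-! ### The transformations `η_ϑ` are cocycles. -/

section Cocycle

variable {k : Type*} [Field k] {N : ℕ}

/-- The bilinear map `a_{lj} s^β ⊗ a_{ji} s^α ↦ ℭ(a_{lj} s^β, a_{ji} s^α) a_{li} s^{β+α+δ(i,j,l)-1}`. -/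
def slideBilin (θ : ℕ → k) (i j l : Ob N) : (ℕ →₀ k) →ₗ[k] (ℕ →₀ k) →ₗ[k] (ℕ →₀ k) :=
  Finsupp.linearCombination k (fun β : ℕ => primitiveCobound θ l j i β •
    Finsupp.lmapDomain k k (fun α : ℕ => β + α + delta i j l - 1))

theorem slideBilin_single (θ : ℕ → k) (i j l : Ob N) (β α : ℕ) (b a : k) :
    slideBilin θ i j l (Finsupp.single β b) (Finsupp.single α a) =
      Finsupp.single (β + α + delta i j l - 1) (primitiveCobound θ l j i β * (b * a)) := by
  simp [slideBilin, mul_left_comm, -Finsupp.single_mul]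

/-- The truncated `- 1` may be moved past the other exponents: either `m ≥ 1`, or the coefficient is
zero. -/
theorem single_sub_one (θ : ℕ → k) (l j i β m u v : ℕ) (c : k) (hm : β + delta i j l ≤ m) :
    Finsupp.single (u + (m - 1) + v) (primitiveCobound θ l j i β * c) =
      Finsupp.single (u + m + v - 1) (primitiveCobound θ l j i β * c) := by
  by_cases h : β + delta i j l = 0
  · rw [show β = 0 by omega, primitiveCobound_eq_zero θ (by omega)]
    simp
  · congr 1
    omega

theorem slideBilin_cocycle (θ : ℕ → k) (i j l n : Ob N) (x y z : ℕ →₀ k) :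
    comp k i l n z (slideBilin θ i j l y x) - comp k i j n (slideBilin θ j l n z y) x
      + slideBilin θ i l n z (comp k i j l y x) - slideBilin θ i j n (comp k j l n z y) x = 0 := by
  induction z using Finsupp.induction_linear with
  | zero => simp
  | add z z' h h' =>
    simp only [map_add, LinearMap.add_apply]
    rw [← add_zero (0 : ℕ →₀ k)]
    nth_rewrite 1 [← h]
    rw [← h']
    abel
  | single γ c =>
  induction y using Finsupp.induction_linear with
  | zero => simp
  | add y y' h h' =>
    simp only [map_add, LinearMap.add_apply]
    rw [← add_zero (0 : ℕ →₀ k)]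
    nth_rewrite 1 [← h]
    rw [← h']
    abel
  | single β b =>
  induction x using Finsupp.induction_linear with
  | zero => simp
  | add x x' h h' =>
    simp only [map_add]
    rw [← add_zero (0 : ℕ →₀ k)]
    nth_rewrite 1 [← h]
    rw [← h']
    abel
  | single α a =>
  have hδ := delta_cocycle i j l n
  have e1 := single_sub_one θ l j i β (β + α + delta i j l) γ (delta i l n) (c * (b * a)) (by omega)
  have e2 := single_sub_one θ n l j γ (γ + β + delta j l n) 0 (α + delta i j n) (c * b * a)
    (by omega)
  rw [zero_add, zero_add, ← add_assoc, ← add_assoc] at e2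
  simp only [slideBilin_single, comp_single]
  rw [show c * (primitiveCobound θ l j i β * (b * a)) =
      primitiveCobound θ l j i β * (c * (b * a)) by ring, e1,
    show primitiveCobound θ n l j γ * (c * b) * a =
      primitiveCobound θ n l j γ * (c * b * a) by ring, e2,
    show γ + β + delta j l n + α + delta i j n =
      γ + (β + α + delta i j l) + delta i l n by omega,
    ← Finsupp.single_sub, ← Finsupp.single_add, ← Finsupp.single_sub]
  rw [Finsupp.single_eq_zero]
  -- All four terms now carry the same monomial. Written through `primitive`, their coefficients
  -- cancel as in `d² = 0`.
  have p1 := primitive_add θ l j i β 0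
  have p2 := primitive_add θ n l j γ β
  have p3 := primitive_add θ n l i γ (β + delta i j l)
  have p4 := primitive_add θ n j i (γ + β + delta j l n) 0
  rw [show γ + β + delta j l n + 0 + delta i j n = γ + (β + delta i j l) + delta i l n by omega] at p4
  rw [← p1, ← p2, ← p3, ← p4, add_zero]
  ring

theorem param_add (ϑ ϑ' : Fin (N - 1) → k) : param (ϑ + ϑ') = param ϑ + param ϑ' := by
  funext m
  simp only [param, Pi.add_apply]
  split_ifs <;> simp

theorem param_smul (c : k) (ϑ : Fin (N - 1) → k) : param (c • ϑ) = c • param ϑ := by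
  funext m
  simp only [param, Pi.smul_apply]
  split_ifs <;> simp

theorem slideBilin_add (θ θ' : ℕ → k) (i j l : Ob N) :
    slideBilin (θ + θ') i j l = slideBilin θ i j l + slideBilin θ' i j l := by
  ext β α : 4
  have h := (primitiveCoboundLin (k := k) l j i β).map_add θ θ'
  simp only [primitiveCoboundLin, LinearMap.coe_mk, AddHom.coe_mk] at h
  simp [slideBilin, h]

theorem slideBilin_smul (c : k) (θ : ℕ → k) (i j l : Ob N) :
    slideBilin (c • θ) i j l = c • slideBilin θ i j l := by
  ext β α : 4
  have h := (primitiveCoboundLin (k := k) l j i β).map_smul c θ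
  simp only [primitiveCoboundLin, LinearMap.coe_mk, AddHom.coe_mk] at h
  simp [slideBilin, h]

/-- The natural transformations `η_ϑ`. -/
def slideTrans (k : Type*) [Field k] (N : ℕ) : (Fin (N - 1) → k) →ₗ[k] NatTrans k N 2 where
  toFun ϑ := ⟨ofBilin (slideBilin (param ϑ)),
    (mem_natTrans_iff _).2 ⟨ofBilin_supported _, slideBilin_cocycle (param ϑ)⟩⟩
  map_add' ϑ ϑ' := by
    refine Subtype.ext (Supported.ext_val₂ (ofBilin_supported _) ?_ fun i j l => ?_)
    · exact ((mem_natTrans_iff _).1 (Subtype.prop _)).1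
    · exact (congrArg (fun θ => slideBilin θ i j l) (param_add ϑ ϑ')).trans (slideBilin_add _ _ i j l)
  map_smul' c ϑ := by
    refine Subtype.ext (Supported.ext_val₂ (ofBilin_supported _) ?_ fun i j l => ?_)
    · exact ((mem_natTrans_iff _).1 (Subtype.prop _)).1
    · exact (congrArg (fun θ => slideBilin θ i j l) (param_smul c ϑ)).trans (slideBilin_smul _ _ i j l)

theorem val₂_slideTrans (ϑ : Fin (N - 1) → k) (i j l : Ob N) :
    val₂ (slideTrans k N ϑ : Family k N) i j l = slideBilin (param ϑ) i j l := rfl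

end Cocycle

/-! ### Square-zero extensions and the obstructions to splitting them. -/

section Extension

variable {k : Type*} [Field k] {N : ℕ}

/-- The object `T_i`, or `T_N` if `i > N`. -/
def ob (N i : ℕ) : Ob N := ⟨min i N, by omega⟩

theorem ob_val {i : ℕ} (h : i ≤ N) : (ob N i : ℕ) = i := min_eq_left h

theorem ob_coe (i : Ob N) : ob N i = i := Fin.ext (ob_val (by omega))

/-- The constant coefficient of the value of `f²` at the relation `p_t q_t = q_{t+1} p_{t+1}`. -/
def relationCoeff (f : Family k N) (t : ℕ) : k :=
  val₂ f (ob N (t + 1)) (ob N t) (ob N (t + 1)) (Finsupp.single 0 1) (Finsupp.single 0 1) 0 -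
  val₂ f (ob N (t + 1)) (ob N (t + 2)) (ob N (t + 1)) (Finsupp.single 0 1) (Finsupp.single 0 1) 0

theorem delta_down_up {t : ℕ} (h : t < N) :
    delta (ob N (t + 1)) (ob N t) (ob N (t + 1)) = 1 := by
  rw [ob_val (by omega), ob_val (by omega), delta_eq, if_neg (by omega), if_pos (by omega)]
  omega

theorem delta_up_down {t : ℕ} (h : t < N) :
    delta (ob N t) (ob N (t + 1)) (ob N t) = 1 := by
  rw [ob_val (by omega), ob_val (by omega), delta_eq, if_pos (by omega), if_pos (by omega)]
  omega

/-- For a coboundary of `θ`, the compositions involving `θ` on an arrow are divisible by `s` because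
`δ = 1`. The remaining terms are `θ` of the same dot and cancel in the difference. -/
theorem relationCoeff_cobound {f : Family k N} (h2 : Supported f 2) (h : f ∈ Cobound k N 2) {t : ℕ}
    (ht : t + 1 < N) : relationCoeff f t = 0 := by
  obtain ⟨θ, hθ⟩ := (mem_cobound_iff h2).1 h
  have d1 : delta (ob N (t + 1)) (ob N t) (ob N (t + 1)) = 1 := delta_down_up (by omega)
  have d2 : delta (ob N (t + 1)) (ob N (t + 2)) (ob N (t + 1)) = 1 := delta_up_down (by omega)
  rw [relationCoeff, hθ, hθ]
  simp only [Finsupp.sub_apply, Finsupp.add_apply, comp_single]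
  rw [comp_apply_zero (by omega), comp_apply_zero (by omega), comp_apply_zero (by omega),
    comp_apply_zero (by omega), d1, d2, sub_self]

/-- The two sides of the relation contribute `ϑ_{t+1}` and `-ϑ_{t+1}`. This is the source of the
condition on the characteristic. -/
theorem relationCoeff_slideTrans (ϑ : Fin (N - 1) → k) {t : ℕ} (ht : t + 1 < N) :
    relationCoeff (slideTrans k N ϑ : Family k N) t = 2 * param ϑ (t + 1) := by
  rw [relationCoeff, val₂_slideTrans, val₂_slideTrans, slideBilin_single, slideBilin_single,
    delta_down_up (by omega), delta_up_down (t := t + 1) (by omega),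
    ob_val (by omega), ob_val (by omega), ob_val (by omega)]
  simp only [primitiveCobound, primitive]
  rw [delta_eq, delta_eq, if_neg (by omega), if_pos (by omega), if_pos (by omega),
    if_pos (by omega), show min t (t + 1) = t by omega, show min (t + 1) t = t by omega,
    show min (t + 1) (t + 2) = t + 1 by omega, show min (t + 2) (t + 1) = t + 1 by omega,
    show min (t + 1 - t) (t + 1 - t) = 1 by omega,
    show min (t + 2 - (t + 1)) (t + 2 - (t + 1)) = 1 by omega,
    slopeSum_succ _ (t + 1), slopeSum_succ, slope_succ]
  simp
  ring

variable {f : Family k N} (hf : f ∈ NatTrans k N 2)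

/-- The square-zero extension of the category by itself that is given by a cocycle. -/
def extension : IndexedCat ((ℕ →₀ k) × (ℕ →₀ k)) where
  mul l j i x y :=
    (comp k (ob N i) (ob N j) (ob N l) x.1 y.1,
      comp k (ob N i) (ob N j) (ob N l) x.1 y.2 + comp k (ob N i) (ob N j) (ob N l) x.2 y.1 +
        val₂ f (ob N i) (ob N j) (ob N l) x.1 y.1)
  -- The cocycle need not be normalized, so the unit is corrected by `-f²(1, 1)`.
  one i := (Finsupp.single 0 1,
    -val₂ f (ob N i) (ob N i) (ob N i) (Finsupp.single 0 1) (Finsupp.single 0 1))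
  -- Associativity in the second component is the cocycle identity.
  assoc n l j i x y z := by
    have h := ((mem_natTrans_iff f).1 hf).2 (ob N i) (ob N j) (ob N l) (ob N n) z.1 y.1 x.1
    refine Prod.ext (comp_assoc _ _ _ _ _ _ _) ?_
    simp only [map_add, LinearMap.add_apply, comp_assoc]
    rw [← sub_eq_zero, ← neg_eq_zero, ← h]
    abel
  one_mul j i x := by
    have h := ((mem_natTrans_iff f).1 hf).2 (ob N i) (ob N j) (ob N j) (ob N j) x.1
      (Finsupp.single 0 1) (Finsupp.single 0 1)
    simp only [comp_id_left] at h
    refine Prod.ext (comp_id_left _ _ _) ?_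
    simp only [comp_id_left, map_neg, LinearMap.neg_apply]
    rw [← sub_eq_zero, ← h]
    abel
  mul_one j i x := by
    have h := ((mem_natTrans_iff f).1 hf).2 (ob N i) (ob N i) (ob N i) (ob N j)
      (Finsupp.single 0 1) (Finsupp.single 0 1) x.1
    simp only [comp_id_right] at h
    refine Prod.ext (comp_id_right _ _ _) ?_
    simp only [comp_id_right, map_neg]
    rw [← sub_eq_zero, ← neg_eq_zero, ← h]
    abel

theorem extension_mul_fst {l j i : ℕ} (hl : l ≤ N) (hj : j ≤ N) (hi : i ≤ N)
    {x y : (ℕ →₀ k) × (ℕ →₀ k)} {β α : ℕ} (hx : x.1 = Finsupp.single β 1)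
    (hy : y.1 = Finsupp.single α 1) :
    ((extension hf).mul l j i x y).1 = Finsupp.single (β + α + delta i j l) 1 := by
  change comp k (ob N i) (ob N j) (ob N l) x.1 y.1 = _
  rw [hx, hy, comp_single, ob_val hl, ob_val hj, ob_val hi, mul_one]

section Path

variable {p q s : ℕ → (ℕ →₀ k) × (ℕ →₀ k)}

theorem extension_pow_fst
    (hs : ∀ i ≤ N, (s i).1 = Finsupp.single 1 1)
    {i : ℕ} (hi : i ≤ N) (n : ℕ) :
    ((extension hf).pow s i n).1 = Finsupp.single n 1 := by
  induction n with
  | zero => rfl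
  | succ n ih =>
    rw [IndexedCat.pow, extension_mul_fst hf hi hi hi (hs i hi) ih]
    congr 1
    simp [delta]
    omega

theorem extension_up_fst
    (hp : ∀ i, (p i).1 = Finsupp.single 0 1)
    {i n : ℕ} (h : i + n ≤ N) :
    ((extension hf).up p i n).1 = Finsupp.single 0 1 := by
  induction n with
  | zero => rfl
  | succ n ih =>
    rw [IndexedCat.up, extension_mul_fst hf (by omega) (by omega) (by omega) (hp _)
      (ih (by omega)), delta_eq, if_pos (by omega), if_neg (by omega)]

theorem extension_down_fst
    (hq : ∀ i, (q i).1 = Finsupp.single 0 1)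
    {i n : ℕ} (h : i + n ≤ N) :
    ((extension hf).down q i n).1 = Finsupp.single 0 1 := by
  induction n with
  | zero => rfl
  | succ n ih =>
    rw [IndexedCat.down, extension_mul_fst hf (by omega) (by omega) (by omega)
      (ih (by omega)) (hq _), delta_eq, if_neg (by omega)]
    congr 1
    split_ifs <;> omega

theorem extension_dotted_fst
    (hp : ∀ i, (p i).1 = Finsupp.single 0 1)
    (hq : ∀ i, (q i).1 = Finsupp.single 0 1)
    (hs : ∀ i ≤ N, (s i).1 = Finsupp.single 1 1)
    {j i : ℕ} (hj : j ≤ N) (hi : i ≤ N) (α : ℕ) :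
    ((extension hf).dotted p q s j i α).1 = Finsupp.single α 1 := by
  have h : ((extension hf).path p q j i).1 = Finsupp.single 0 1 := by
    unfold IndexedCat.path
    split_ifs
    · exact extension_up_fst hf hp (by omega)
    · exact extension_down_fst hf hq (by omega)
  rw [IndexedCat.dotted, extension_mul_fst hf hj hi hi h (extension_pow_fst hf hs hi α)]
  congr 1
  rw [delta_eq]
  split_ifs <;> omega

end Path

/-- A cocycle whose extension has lifts of the arrows that satisfy the relations is a coboundary. -/
theorem mem_cobound_of_lifts {p q s : ℕ → (ℕ →₀ k) × (ℕ →₀ k)}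
    (hp : ∀ i, (p i).1 = Finsupp.single 0 1) (hq : ∀ i, (q i).1 = Finsupp.single 0 1)
    (hs : ∀ i ≤ N, (s i).1 = Finsupp.single 1 1)
    (hqp : ∀ i < N, (extension hf).mul i (i + 1) i (q i) (p i) = s i)
    (hpq : ∀ i < N, (extension hf).mul (i + 1) i (i + 1) (p i) (q i) = s (i + 1)) :
    f ∈ Cobound k N 2 := by
  rw [mem_cobound_iff ((mem_natTrans_iff f).1 hf).1]
  -- The dotted paths of lifts give a multiplicative section `x ↦ (x, φ x)`. Multiplicativity reads
  -- `x φ(y) + φ(x) y + f²(x, y) = φ(x y)`, so `-φ` has coboundary `f²`.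
  refine ⟨fun i j => -Finsupp.linearCombination k
    (fun α : ℕ => ((extension hf).dotted p q s j i α).2), fun i j l x y => ?_⟩
  induction y using Finsupp.induction_linear with
  | zero => simp
  | add y y' h h' =>
    simp only [map_add, LinearMap.add_apply, h, h']
    abel
  | single β b =>
  induction x using Finsupp.induction_linear with
  | zero => simp
  | add x x' h h' =>
    simp only [map_add, h, h']
    abel
  | single α a =>
  have e := congrArg Prod.snd (IndexedCat.dotted_comp_dotted (l := l) hqp hpq
    (j := j) (i := i) (by omega) (by omega) β α)
  have e' : comp k (ob N i) (ob N j) (ob N l) ((extension hf).dotted p q s l j β).1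
      ((extension hf).dotted p q s j i α).2 +
      comp k (ob N i) (ob N j) (ob N l) ((extension hf).dotted p q s l j β).2
      ((extension hf).dotted p q s j i α).1 +
      val₂ f (ob N i) (ob N j) (ob N l) ((extension hf).dotted p q s l j β).1
      ((extension hf).dotted p q s j i α).1 =
      ((extension hf).dotted p q s l i (β + α + delta i j l)).2 := e
  rw [extension_dotted_fst hf hp hq hs (by omega) (by omega),
    extension_dotted_fst hf hp hq hs (by omega) (by omega), ob_coe, ob_coe, ob_coe] at e'
  have hb : (Finsupp.single β b : ℕ →₀ k) = b • Finsupp.single β 1 := by simp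
  have ha : (Finsupp.single α a : ℕ →₀ k) = a • Finsupp.single α 1 := by simp
  rw [hb, ha]
  simp only [map_smul, LinearMap.smul_apply, comp_single, LinearMap.neg_apply,
    Finsupp.linearCombination_single, mul_one, one_smul, map_neg]
  simp only [← e', smul_neg, smul_add]
  abel

/-- A defect without constant term is divisible by `s`. The quotients accumulate along the line of
objects, since correcting `q_t` also affects the relation at the preceding interior object. -/
theorem exists_lifts_correction (h : ∀ t, t + 1 < N → relationCoeff f t = 0) :
    ∃ Q : ℕ → ℕ →₀ k, ∀ t, t + 1 < N → Finsupp.mapDomain (· + 1) (Q (t + 1)) =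
      Finsupp.mapDomain (· + 1) (Q t) +
      (val₂ f (ob N (t + 1)) (ob N t) (ob N (t + 1)) (Finsupp.single 0 1) (Finsupp.single 0 1) -
        val₂ f (ob N (t + 1)) (ob N (t + 2)) (ob N (t + 1))
          (Finsupp.single 0 1) (Finsupp.single 0 1)) := by
  have hD : ∀ t, ∃ D : ℕ →₀ k, t + 1 < N → Finsupp.mapDomain (· + 1) D =
      val₂ f (ob N (t + 1)) (ob N t) (ob N (t + 1)) (Finsupp.single 0 1) (Finsupp.single 0 1) -
        val₂ f (ob N (t + 1)) (ob N (t + 2)) (ob N (t + 1))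
          (Finsupp.single 0 1) (Finsupp.single 0 1) := by
    intro t
    by_cases ht : t + 1 < N
    · obtain ⟨D, hD⟩ := exists_mapDomain_add_one
        (val₂ f (ob N (t + 1)) (ob N t) (ob N (t + 1)) (Finsupp.single 0 1) (Finsupp.single 0 1) -
        val₂ f (ob N (t + 1)) (ob N (t + 2)) (ob N (t + 1))
          (Finsupp.single 0 1) (Finsupp.single 0 1)) (h t ht)
      exact ⟨D, fun _ => hD⟩
    · exact ⟨0, fun h => absurd h ht⟩
  choose D hD using hD
  refine ⟨fun t => ∑ r ∈ range t, D r, fun t ht => ?_⟩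
  simp only [sum_range_succ]
  rw [Finsupp.mapDomain_add, hD t ht]

theorem mem_cobound_of_relationCoeff
    (hf : f ∈ NatTrans k N 2)
    (h : ∀ t, t + 1 < N → relationCoeff f t = 0) :
    f ∈ Cobound k N 2 := by
  obtain ⟨Q, hQ⟩ := exists_lifts_correction h
  let p : ℕ → (ℕ →₀ k) × (ℕ →₀ k) := fun _ => (Finsupp.single 0 1, 0)
  let q : ℕ → (ℕ →₀ k) × (ℕ →₀ k) := fun i => (Finsupp.single 0 1, Q i)
  -- The lifted dot is `q_i p_i` where `p_i` exists and `p_{N-1} q_{N-1}` at the last object, so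
  -- only the interior relations remain to be checked. For `N = 0` there are no arrows and the dot
  -- is a free loop with an arbitrary lift.
  let s : ℕ → (ℕ →₀ k) × (ℕ →₀ k) := fun i =>
    if i < N then (extension hf).mul i (i + 1) i (q i) (p i)
    else if i = 0 then (Finsupp.single 1 1, 0)
    else (extension hf).mul i (i - 1) i (p (i - 1)) (q (i - 1))
  refine mem_cobound_of_lifts hf (p := p) (q := q) (s := s) (fun _ => rfl) (fun _ => rfl) ?_ ?_ ?_
  · intro i hi
    simp only [s]
    split_ifs with h1 h0
    · rw [extension_mul_fst hf (by omega) (by omega) (by omega) (β := 0) (α := 0) rfl rfl, delta_eq,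
        if_pos (by omega), if_pos (by omega)]
      congr 1
      omega
    · rfl
    · rw [extension_mul_fst hf (by omega) (by omega) (by omega) (β := 0) (α := 0) rfl rfl, delta_eq,
        if_neg (by omega), if_pos (by omega)]
      congr 1
      omega
  · intro i hi
    simp only [s, if_pos hi]
  · intro i hi
    simp only [s]
    by_cases h1 : i + 1 < N
    · rw [if_pos h1]
      refine Prod.ext ?_ ?_
      · rw [extension_mul_fst hf (by omega) (by omega) (by omega) (β := 0) (α := 0) rfl rfl,
          extension_mul_fst hf (by omega) (by omega) (by omega) (β := 0) (α := 0) rfl rfl, delta_eq,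
          delta_eq, if_neg (by omega), if_pos (by omega), if_pos (by omega), if_pos (by omega)]
        congr 1
        omega
      · simp only [extension, p, q, map_zero, LinearMap.zero_apply, add_zero, zero_add]
        rw [comp_one_left, comp_one_right, delta_down_up hi, delta_up_down (t := i + 1) h1, hQ i h1]
        abel
    · rw [if_neg h1, if_neg (by omega), Nat.add_sub_cancel]

end Extension

end KLRW

end

theorem mainTheorem4 {k : Type*} [Field k] (h2 : (2 : k) ≠ 0) (N : ℕ) :
    ∃ η : (Fin (N - 1) → k) →ₗ[k] KLRW.NatTrans k N 2,
      (∀ (ϑ : Fin (N - 1) → k) (i j l : KLRW.Ob N) (α β : ℕ),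
        KLRW.ev (η ϑ : KLRW.Family k N) 2
            (fun p => if p = 0 then i else if p = 1 then j else l)
            (fun p => if p = 0 then KLRW.gen k j i α else KLRW.gen k l j β) =
          KLRW.coeff (KLRW.param ϑ) l j i β •
            KLRW.gen k l i (β + α + KLRW.delta i j l - 1)) ∧
      (∀ (ϑ : Fin (N - 1) → k) (d : ℕ), d ≠ 2 → (η ϑ : KLRW.Family k N) d = 0) ∧
      Function.Bijective (KLRW.HH.mk k N 2 ∘ₗ η) ∧
      (∀ (ϑ : Fin (N - 1) → k) (l j i : KLRW.Ob N) (β : ℕ),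
        KLRW.coeff (KLRW.param ϑ) l j i β = KLRW.slide (KLRW.param ϑ) l j i β) := by
  have hsupp : ∀ f : KLRW.NatTrans k N 2, KLRW.Supported (f : KLRW.Family k N) 2 :=
    fun f => ((KLRW.mem_natTrans_iff _).1 f.2).1
  have hmem : ∀ f : KLRW.NatTrans k N 2, KLRW.HH.mk k N 2 f = 0 ↔
      (f : KLRW.Family k N) ∈ KLRW.Cobound k N 2 := by
    intro f
    rw [KLRW.HH.mk, Submodule.mkQ_apply, Submodule.Quotient.mk_eq_zero]
    rfl
  refine ⟨KLRW.slideTrans k N, fun ϑ i j l α β => ?_, fun ϑ => hsupp _, ⟨?_, ?_⟩,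
    fun ϑ l j i β => ?_⟩
  · refine (KLRW.ev_two _ _ _).trans ?_
    refine (KLRW.slideBilin_single (KLRW.param ϑ) i j l β α 1 1).trans ?_
    rw [KLRW.coeff_eq_primitiveCobound, KLRW.gen, Finsupp.smul_single, smul_eq_mul, mul_one]
  · rw [injective_iff_map_eq_zero]
    intro ϑ h
    funext t
    have ht : (t : ℕ) + 1 < N := by omega
    have h0 := KLRW.relationCoeff_cobound (hsupp _) ((hmem _).1 h) ht
    rw [KLRW.relationCoeff_slideTrans ϑ ht] at h0
    have h1 := (mul_eq_zero.1 h0).resolve_left h2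
    rwa [KLRW.param, dif_pos (by omega)] at h1
  · intro c
    obtain ⟨f, rfl⟩ := Submodule.mkQ_surjective _ c
    -- Index `t` of `Fin (N - 1)` stands for `ϑ_{t+1}`. This choice matches every obstruction of
    -- `f`, so the difference is a coboundary.
    let ϑ : Fin (N - 1) → k := fun t => KLRW.relationCoeff (f : KLRW.Family k N) t / 2
    refine ⟨ϑ, ?_⟩
    change KLRW.HH.mk k N 2 (KLRW.slideTrans k N ϑ) = KLRW.HH.mk k N 2 f
    rw [← sub_eq_zero, ← map_sub, hmem]
    refine KLRW.mem_cobound_of_relationCoeff (Subtype.prop _) fun t ht => ?_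
    have e : KLRW.relationCoeff ((KLRW.slideTrans k N ϑ - f : KLRW.NatTrans k N 2) :
        KLRW.Family k N) t = KLRW.relationCoeff (KLRW.slideTrans k N ϑ : KLRW.Family k N) t -
          KLRW.relationCoeff (f : KLRW.Family k N) t :=
      sub_sub_sub_comm _ _ _ _
    rw [e, KLRW.relationCoeff_slideTrans ϑ ht, KLRW.param, dif_pos (by omega)]
    simp only [ϑ, Nat.add_sub_cancel]
    rw [mul_div_cancel₀ _ h2, sub_self]
  · rw [KLRW.coeff_eq_primitiveCobound, KLRW.slide_eq_primitiveCobound]
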